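/- Let $\mathfrak H$ be a complex Hilbert space, let $B_1,B_2$ be densely defined closed operators in $\mathfrak H$, and let $S=B_1\cap B_2$ be their intersection, that is, $Sf=B_1f=B_2f$ on $\operatorname{dom}(S)=\{f\in\operatorname{dom}(B_1)\cap\operatorname{dom}(B_2): B_1f=B_2f\}$. Assume that $S$ is densely defined and symmetric, and let $A_0$ be a self-adjoint extension of $S$ such that $$S=A_0\cap B_1=A_0\cap B_2=A_0\cap B_1^*=A_0\cap B_2^*.$$ Let $\{\mathcal G,\Gamma_0,\Gamma_1\}$ be a boundary triple for $S^*$, that is, $\mathcal G$ is a complex Hilbert space and $\Gamma_0,\Gamma_1:\operatorname{dom}(S^*)\to\mathcal G$ are linear maps such that $f\mapsto(\Gamma_0f,\Gamma_1f)$ is onto $\mathcal G\times\mathcal G$ and, with scalar products linear in the first entry, $$(S^*f,g)_{\mathfrak H}-(f,S^*g)_{\mathfrak H}=(\Gamma_1f,\Gamma_0g)_{\mathcal G}-(\Gamma_0f,\Gamma_1g)_{\mathcal G},\qquad f,g\in\operatorname{dom}(S^*).$$ Assume that $A_0=S^*\upharpoonright\ker(\Gamma_0)$, and let $\Theta_1,\Theta_2$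 be densely defined closed operators in $\mathcal G$ with $$B_j=S^*\upharpoonright\ker(\Gamma_1-\Theta_j\Gamma_0)=S^*\upharpoonright\{f\in\operatorname{dom}(S^*):\Gamma_0f\in\operatorname{dom}(\Theta_j),\ \Gamma_1f=\Theta_j\Gamma_0f\},\qquad j=1,2.$$ Let $M(z)=\Gamma_1\bigl(\Gamma_0\upharpoonright\ker(S^*-z)\bigr)^{-1}$, $z\in\rho(A_0)$, be the corresponding Weyl--Titchmarsh function. For a closed operator $T$ let $m_a(z;T)$ be the dimension of the algebraic eigenspace $\bigcup_{n}\ker((T-z)^n)$ (so $m_a(z;T)=0$ for $z\in\rho(T)$), and let the discrete spectrum $\sigma_d(T)$ be the set of eigenvalues of $T$ that are isolated in $\sigma(T)$ and of finite algebraic multiplicity, in the sense that the Riesz projection $-\frac1{2\pi i}\oint_{C(z;\varepsilon)}(T-\zeta)^{-1}d\zeta$, $\varepsilon>0$ small, has finite rank. Here $D(z;\varepsilon)$ is the open disc and $C(z;\varepsilon)$ its counterclockwise oriented boundary circle. A $\mathcal B(\mathcal G)$-valued function is called finitely meromorphic at a point if near this point it is the sum of an analytic function and a finite principal part whose coefficients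 have finite rank, and finitely meromorphic on an open set if this holds at every point of the set. For $\Omega\subseteq\mathbb C$ open and connected and $\mathcal D_0\subset\Omega$ without limit points in $\Omega$, a function $N(\cdot)$ on $\Omega\setminus\mathcal D_0$ whose values are densely defined closed operators in $\mathcal G$ satisfies the index hypothesis on $(\Omega,\mathcal D_0)$ if 1. $\operatorname{dom}(N(z))=:\mathcal N_0$ does not depend on $z\in\Omega\setminus\mathcal D_0$; 2. $N(z)^{-1}\in\mathcal B(\mathcal G)$ for all $z\in\Omega\setminus\mathcal D_0$; 3. $N(\cdot)^{-1}$ is analytic on $\Omega\setminus\mathcal D_0$ and finitely meromorphic on $\Omega$; 4. $N(\cdot)\varphi$ is analytic on $\Omega\setminus\mathcal D_0$ for every $\varphi\in\mathcal N_0$; 5. for $z\in\Omega\setminus\mathcal D_0$ the operator $N'(z)$, defined on $\mathcal N_0$ by $N'(z)\varphi=\frac{d}{dz}N(z)\varphi$, extends to an operator $\overline{N'(z)}\in\mathcal B(\mathcal G)$, and $\overline{N'(\cdot)}$ is analytic on $\Omega\setminus\mathcal D_0$ and finitely meromorphic on $\Omega$. In this case, for $z_0\in\Omega$ and small $\varepsilon>0$,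 the generalized index is $$\widetilde{\operatorname{ind}}_{C(z_0;\varepsilon)}(N(\cdot))=\operatorname{tr}_{\mathcal G}\Bigl(\frac1{2\pi i}\oint_{C(z_0;\varepsilon)}\overline{N'(\zeta)}\,N(\zeta)^{-1}\,d\zeta\Bigr).$$ **Theorem.** Assume that $z_0\in\sigma_d(B_j)\cup\rho(B_j)$ for $j=1,2$ and $z_0\in\sigma_d(A_0)\cup\rho(A_0)$. Then there exists $\varepsilon_0>0$ such that both functions $\Theta_j-M(\cdot)$, $j=1,2$, satisfy the index hypothesis on $(D(z_0;\varepsilon_0),\{z_0\})$, and for all $0<\varepsilon<\varepsilon_0$ the operators whose traces define the two generalized indices have finite rank and $$\widetilde{\operatorname{ind}}_{C(z_0;\varepsilon)}(\Theta_1-M(\cdot))-\widetilde{\operatorname{ind}}_{C(z_0;\varepsilon)}(\Theta_2-M(\cdot))=m_a(z_0;B_1)-m_a(z_0;B_2).$$ -/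

import Mathlib

namespace ExtIndex

noncomputable section

section Operators

variable {H : Type*} [NormedAddCommGroup H] [InnerProductSpace ℂ H]

/-- The difference `T - K` of an unbounded operator `T` and an everywhere defined linear map `K`,
with domain `dom (T - K) = dom T`. -/
def subMap (T : H →ₗ.[ℂ] H) (K : H →ₗ[ℂ] H) : H →ₗ.[ℂ] H where
  domain := T.domain
  toFun := T.toFun - K ∘ₗ T.domain.subtype

/-- The operator `T - z I`, with domain `dom T`. -/
def shift (T : H →ₗ.[ℂ] H) (z : ℂ) : H →ₗ.[ℂ] H :=
  subMap T (z • LinearMap.id)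

/-- `R` is an everywhere defined bounded two-sided inverse of the unbounded operator `T`. -/
def IsBoundedInverse (T : H →ₗ.[ℂ] H) (R : H →L[ℂ] H) : Prop :=
  (∀ y : H, ∃ h : R y ∈ T.domain, T ⟨R y, h⟩ = y) ∧ ∀ x : T.domain, R (T x) = x

/-- `T` is boundedly invertible. -/
def BoundedlyInvertible (T : H →ₗ.[ℂ] H) : Prop :=
  ∃ R : H →L[ℂ] H, IsBoundedInverse T R

open Classical in
/-- The (unique) bounded inverse `T⁻¹` of a boundedly invertible operator; `0` otherwise. -/
def boundedInverse (T : H →ₗ.[ℂ] H) : H →L[ℂ] H :=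
  if h : BoundedlyInvertible T then h.choose else 0

/-- The resolvent set `ρ(T)`. -/
def resSet (T : H →ₗ.[ℂ] H) : Set ℂ :=
  {z | BoundedlyInvertible (shift T z)}

/-- The resolvent `(T - z I)⁻¹`. -/
def resolventOp (T : H →ₗ.[ℂ] H) (z : ℂ) : H →L[ℂ] H :=
  boundedInverse (shift T z)

/-- Bounded operators with finite-dimensional range. -/
def FiniteRank (K : H →L[ℂ] H) : Prop :=
  FiniteDimensional ℂ (LinearMap.range (K : H →ₗ[ℂ] H))

/-- The trace of a finite rank operator `K`: the trace of `K` on its finite-dimensional invariant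
subspace `ran K`. -/
def finiteRankTrace (K : H →L[ℂ] H) : ℂ :=
  LinearMap.trace ℂ (LinearMap.range (K : H →ₗ[ℂ] H))
    ((K : H →ₗ[ℂ] H).rangeRestrict ∘ₗ (LinearMap.range (K : H →ₗ[ℂ] H)).subtype)

/-- The Riesz projection `-(2πi)⁻¹ ∮_{C(z₀;ε)} (T - ζ I)⁻¹ dζ`. -/
def rieszProjection (T : H →ₗ.[ℂ] H) (z₀ : ℂ) (ε : ℝ) : H →L[ℂ] H :=
  -((2 * Real.pi * Complex.I : ℂ)⁻¹ • ∮ ζ in C(z₀, ε), resolventOp T ζ)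

/-- The kernels `ker (T - z I)^n`, where the powers carry their natural domains. -/
def kerPow (T : H →ₗ.[ℂ] H) (z : ℂ) : ℕ → Submodule ℂ H
  | 0 => ⊥
  | n + 1 => ((kerPow T z n).comap (shift T z).toFun).map T.domain.subtype

/-- The algebraic eigenspace `⋃ n, ker (T - z I)^n` of `T` at `z`. -/
def algEigenspace (T : H →ₗ.[ℂ] H) (z : ℂ) : Submodule ℂ H :=
  ⨆ n, kerPow T z n

/-- The algebraic multiplicity `m_a(z;T)`, the dimension of the algebraic eigenspace.
It is `0` for `z ∈ ρ(T)`. -/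
def algMult (T : H →ₗ.[ℂ] H) (z : ℂ) : ℕ :=
  Module.finrank ℂ (algEigenspace T z)

/-- The discrete spectrum `σ_d(T)`: eigenvalues that are isolated in the spectrum and have finite
algebraic multiplicity. As usual for isolated points of the spectrum of a closed
operator, finite algebraic multiplicity means that the Riesz projection, taken over any circle
that separates the point from the rest of the spectrum, has finite rank; its range is then the
algebraic eigenspace. -/
def discreteSpectrum (T : H →ₗ.[ℂ] H) : Set ℂ :=
  {z₀ | (∃ x : T.domain, (x : H) ≠ 0 ∧ T x = z₀ • (x : H)) ∧
    ∃ ε₀ > 0, Metric.ball z₀ ε₀ \ {z₀} ⊆ resSet T ∧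
      ∀ ε, 0 < ε → ε < ε₀ → FiniteRank (rieszProjection T z₀ ε)}

end Operators

section Meromorphic

variable {G : Type*} [NormedAddCommGroup G] [InnerProductSpace ℂ G]

/-- `F` is finitely meromorphic at `z₀`: on a punctured disc around `z₀` it is the sum of a
finite principal part `∑_{k=1}^{N} (z - z₀)^{-k} A_k` with finite rank coefficients and of a
function that is analytic at `z₀`. -/
def FinitelyMeromorphicAt (F : ℂ → G →L[ℂ] G) (z₀ : ℂ) : Prop :=
  ∃ (N : ℕ) (A : ℕ → G →L[ℂ] G) (g : ℂ → G →L[ℂ] G),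
    (∀ k, FiniteRank (A k)) ∧ AnalyticAt ℂ g z₀ ∧
    ∀ᶠ z in nhdsWithin z₀ {z₀}ᶜ,
      F z = (∑ k ∈ Finset.Icc 1 N, ((z - z₀) ^ k)⁻¹ • A k) + g z

/-- `F` is finitely meromorphic on `Ω`. (At a point that is not a pole the condition is
meromorphy with empty principal part.) -/
def FinitelyMeromorphicOn (F : ℂ → G →L[ℂ] G) (Ω : Set ℂ) : Prop :=
  ∀ z ∈ Ω, FinitelyMeromorphicAt F z

open Classical in
/-- The value `T φ` for `φ ∈ dom T`, extended by `0` to all of `G`. -/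
def value (T : G →ₗ.[ℂ] G) (φ : G) : G :=
  if h : φ ∈ T.domain then T ⟨φ, h⟩ else 0

/-- `K` is a bounded continuation of the operator `M'(z)`, which is defined on `dom M(z)` by
`M'(z) φ = d/dz (M(z) φ)`. -/
def IsDerivExtension (M : ℂ → G →ₗ.[ℂ] G) (z : ℂ) (K : G →L[ℂ] G) : Prop :=
  ∀ φ ∈ (M z).domain, K φ = deriv (fun w => value (M w) φ) z

open Classical in
/-- The bounded continuation of `M'(z)` to all of `G` (unique if `dom M(z)` is dense);
`0` if there is none. -/
def derivClosure (M : ℂ → G →ₗ.[ℂ] G) (z : ℂ) : G →L[ℂ] G :=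
  if h : ∃ K : G →L[ℂ] G, IsDerivExtension M z K then h.choose else 0

/-- The hypothesis under which the generalized index of a family `M(·)` of densely defined closed
operators on `Ω \ D₀` is defined. -/
structure IndexHypothesis (M : ℂ → G →ₗ.[ℂ] G) (Ω D₀ : Set ℂ) : Prop where
  isOpen : IsOpen Ω
  isConnected : IsConnected Ω
  subset : D₀ ⊆ Ω
  /-- `D₀` has no limit points in `Ω` -/
  discrete : ∀ z ∈ Ω, ¬ AccPt z (Filter.principal D₀)
  dense : ∀ z ∈ Ω \ D₀, Dense ((M z).domain : Set G)
  closed : ∀ z ∈ Ω \ D₀, (M z).IsClosed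
  /-- (i) the domain is independent of `z` -/
  domain_eq : ∀ z ∈ Ω \ D₀, ∀ w ∈ Ω \ D₀, (M z).domain = (M w).domain
  /-- (ii) -/
  invertible : ∀ z ∈ Ω \ D₀, BoundedlyInvertible (M z)
  /-- (iii) -/
  inverse_analytic : AnalyticOnNhd ℂ (fun z => boundedInverse (M z)) (Ω \ D₀)
  inverse_finMero : FinitelyMeromorphicOn (fun z => boundedInverse (M z)) Ω
  /-- (iv) -/
  strongly_analytic : ∀ φ : G, (∀ z ∈ Ω \ D₀, φ ∈ (M z).domain) →
    AnalyticOnNhd ℂ (fun z => value (M z) φ) (Ω \ D₀)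
  /-- (v) -/
  deriv_bounded : ∀ z ∈ Ω \ D₀, ∃ K : G →L[ℂ] G, IsDerivExtension M z K
  deriv_analytic : AnalyticOnNhd ℂ (derivClosure M) (Ω \ D₀)
  deriv_finMero : FinitelyMeromorphicOn (derivClosure M) Ω

/-- The operator `(2πi)⁻¹ ∮_{C(z₀;ε)} closure(M'(ζ)) M(ζ)⁻¹ dζ`. -/
def indexOperator (M : ℂ → G →ₗ.[ℂ] G) (z₀ : ℂ) (ε : ℝ) : G →L[ℂ] G :=
  (2 * Real.pi * Complex.I : ℂ)⁻¹ •
    ∮ ζ in C(z₀, ε), derivClosure M ζ ∘L boundedInverse (M ζ)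

/-- The generalized index of `M(·)` with respect to the circle `C(z₀;ε)`. -/
def generalizedIndex (M : ℂ → G →ₗ.[ℂ] G) (z₀ : ℂ) (ε : ℝ) : ℂ :=
  finiteRankTrace (indexOperator M z₀ ε)

end Meromorphic

section BoundaryTriples

variable {H : Type*} [NormedAddCommGroup H] [InnerProductSpace ℂ H] [CompleteSpace H]

/-- A boundary triple `{G, Γ₀, Γ₁}` for the adjoint `S*`. Mathlib's inner product is conjugate
linear in its first entry, so `inner ℂ g f` is `(f, g)` in the convention in which scalar products
are linear in the first entry. -/
structure BoundaryTriple (S : H →ₗ.[ℂ] H) (G : Type*) [NormedAddCommGroup G]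
    [InnerProductSpace ℂ G] where
  Γ₀ : S.adjoint.domain →ₗ[ℂ] G
  Γ₁ : S.adjoint.domain →ₗ[ℂ] G
  green : ∀ f g : S.adjoint.domain,
    inner ℂ (g : H) (S.adjoint f) - inner ℂ (S.adjoint g) (f : H) =
      inner ℂ (Γ₀ g) (Γ₁ f) - inner ℂ (Γ₁ g) (Γ₀ f)
  surjective : Function.Surjective (Γ₀.prod Γ₁)

variable {S : H →ₗ.[ℂ] H} {G : Type*} [NormedAddCommGroup G] [InnerProductSpace ℂ G]

namespace BoundaryTriple

/-- The restriction of `S*` to `ker Γ₀`. -/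
def kerExtension (b : BoundaryTriple S G) : H →ₗ.[ℂ] H :=
  S.adjoint.domRestrict ((LinearMap.ker b.Γ₀).map S.adjoint.domain.subtype)

/-- The restriction of `S*` to `ker (Γ₁ - Θ Γ₀)`, that is, to the set of all `f ∈ dom S*` with
`Γ₀ f ∈ dom Θ` and `Γ₁ f = Θ Γ₀ f`. -/
def extension (b : BoundaryTriple S G) (Θ : G →ₗ.[ℂ] G) : H →ₗ.[ℂ] H :=
  S.adjoint.domRestrict ((Θ.graph.comap (b.Γ₀.prod b.Γ₁)).map S.adjoint.domain.subtype)

/-- `ker (S* - z I)` as a subspace of `dom S*`. -/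
def defect (S : H →ₗ.[ℂ] H) (z : ℂ) : Submodule ℂ S.adjoint.domain :=
  LinearMap.ker (shift S.adjoint z).toFun

open Classical in
/-- The inverse `(Γ₀ ↾ ker (S* - z I))⁻¹`, with values in `dom S*`. The restriction is bijective
for `z ∈ ρ(S* ↾ ker Γ₀)`; where it is not bijective the value is `0`. -/
def gammaField (b : BoundaryTriple S G) (z : ℂ) : G →ₗ[ℂ] S.adjoint.domain :=
  if h : Function.Bijective (b.Γ₀.domRestrict (defect S z)) then
    (defect S z).subtype ∘ₗ (LinearEquiv.ofBijective _ h).symm.toLinearMap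
  else 0

/-- The Weyl–Titchmarsh function `M(z) = Γ₁ (Γ₀ ↾ ker (S* - z I))⁻¹`. -/
def weyl (b : BoundaryTriple S G) (z : ℂ) : G →ₗ[ℂ] G :=
  b.Γ₁ ∘ₗ b.gammaField z

end BoundaryTriple

/-- The standing hypothesis on `B₁`, `B₂`, `S` and `A₀`. The infimum of two operators is their
intersection: it is defined where both are defined and agree. -/
structure ExtensionHypothesis (B₁ B₂ S A₀ : H →ₗ.[ℂ] H) : Prop where
  dense₁ : Dense (B₁.domain : Set H)
  dense₂ : Dense (B₂.domain : Set H)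
  closed₁ : B₁.IsClosed
  closed₂ : B₂.IsClosed
  eq_inf : S = B₁ ⊓ B₂
  dense : Dense (S.domain : Set H)
  symmetric : S.IsFormalAdjoint S
  selfAdjoint : IsSelfAdjoint A₀
  disjoint₁ : S = A₀ ⊓ B₁
  disjoint₂ : S = A₀ ⊓ B₂
  disjoint_adjoint₁ : S = A₀ ⊓ B₁.adjoint
  disjoint_adjoint₂ : S = A₀ ⊓ B₂.adjoint

end BoundaryTriples

end

end ExtIndex

open ExtIndex

/-! The two parameters decouple. For each `Θ` alone, with `B` the extension given by `Θ`, the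
generalized index of `Θ - M(·)` at `z₀` equals `m_a(z₀;B) - m_a(z₀;A₀)`; subtracting the two cases
removes `A₀`.

Two identities give this (`krein_formula`, `weylL_sub`): Krein's formula `(B - z)⁻¹ - (A₀ - z)⁻¹ =
γ(z) (Θ - M(z))⁻¹ γ(z̄)*` and `M'(z) = γ(z̄)* γ(z)`. The index integrand is therefore `-γ(z̄)* ·
γ(z) (Θ - M(z))⁻¹`. Moving the first factor to the end under the trace turns it into minus the
resolvent difference, whose contour integral is the difference of the Riesz projections of `B` and
`A₀`. The trace of a finite rank Riesz projection is the algebraic multiplicity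
(`finiteRankTrace_rieszProjection`).

The integrand itself need not have finite rank, so cyclicity of the trace is proved for the
integrals (`FinMero.traceSymm`): analytic parts integrate to zero, and every other contribution
contains a finite rank coefficient. This requires all factors to be finitely meromorphic. For the
resolvents it follows from nilpotency of `T - z₀` on the range of the Riesz projection
(`resolventOp_finMero`); `γ`, `γ*` and `(Θ - M)⁻¹` are expressed through the resolvents and
operators fixed at a base point (`gammaL_transfer`, `gammaAdj_transfer`,
`isBoundedInverse_weylInv`). -/

namespace ExtIndex

open Filter Topology

/-! ### Finite rank operators between two spaces. -/

section FiniteRankMaps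

variable {X Y Z : Type*} [NormedAddCommGroup X] [NormedSpace ℂ X] [NormedAddCommGroup Y]
  [NormedSpace ℂ Y] [NormedAddCommGroup Z] [NormedSpace ℂ Z]

/-- Bounded operators with finite-dimensional range, between possibly different spaces. -/
def FinRank (A : X →L[ℂ] Y) : Prop :=
  FiniteDimensional ℂ (LinearMap.range (A : X →ₗ[ℂ] Y))

theorem FinRank.of_forall_mem {A : X →L[ℂ] Y} {W : Submodule ℂ Y} [FiniteDimensional ℂ W]
    (h : ∀ x, A x ∈ W) : FinRank A := by
  have hle : LinearMap.range (A : X →ₗ[ℂ] Y) ≤ W := by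
    rintro _ ⟨x, rfl⟩
    exact h x
  exact Submodule.finiteDimensional_of_le hle

theorem FinRank.zero : FinRank (0 : X →L[ℂ] Y) :=
  FinRank.of_forall_mem (W := ⊥) (by simp)

theorem FinRank.add {A B : X →L[ℂ] Y} (hA : FinRank A) (hB : FinRank B) : FinRank (A + B) := by
  unfold FinRank at hA hB
  exact FinRank.of_forall_mem
    (W := LinearMap.range (A : X →ₗ[ℂ] Y) ⊔ LinearMap.range (B : X →ₗ[ℂ] Y))
    fun x => Submodule.add_mem_sup ⟨x, rfl⟩ ⟨x, rfl⟩

theorem FinRank.smul {A : X →L[ℂ] Y} (hA : FinRank A) (c : ℂ) : FinRank (c • A) := by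
  unfold FinRank at hA
  exact FinRank.of_forall_mem (W := LinearMap.range (A : X →ₗ[ℂ] Y))
    fun x => Submodule.smul_mem _ c ⟨x, rfl⟩

theorem FinRank.comp_right {A : Y →L[ℂ] Z} (hA : FinRank A) (B : X →L[ℂ] Y) :
    FinRank (A ∘L B) := by
  unfold FinRank at hA
  exact FinRank.of_forall_mem (W := LinearMap.range (A : Y →ₗ[ℂ] Z)) fun x => ⟨B x, rfl⟩

theorem FinRank.comp_left {A : X →L[ℂ] Y} (hA : FinRank A) (B : Y →L[ℂ] Z) :
    FinRank (B ∘L A) := by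
  unfold FinRank at hA
  exact FinRank.of_forall_mem (W := (LinearMap.range (A : X →ₗ[ℂ] Y)).map (B : Y →ₗ[ℂ] Z))
    fun x => ⟨A x, ⟨x, rfl⟩, rfl⟩

end FiniteRankMaps

/-! ### The trace of finite rank operators. -/

section Trace

variable {X Y : Type*} [NormedAddCommGroup X] [InnerProductSpace ℂ X] [NormedAddCommGroup Y]
  [InnerProductSpace ℂ Y]

/-- The trace may be computed on any finite-dimensional subspace that contains the range. -/
theorem finiteRankTrace_eq {K : X →L[ℂ] X} {W : Submodule ℂ X} [FiniteDimensional ℂ W]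
    (h : ∀ x, K x ∈ W) :
    finiteRankTrace K =
      LinearMap.trace ℂ W (((K : X →ₗ[ℂ] X).codRestrict W h) ∘ₗ W.subtype) := by
  have hle : LinearMap.range (K : X →ₗ[ℂ] X) ≤ W := by
    rintro _ ⟨x, rfl⟩
    exact h x
  have : FiniteDimensional ℂ (LinearMap.range (K : X →ₗ[ℂ] X)) :=
    Submodule.finiteDimensional_of_le hle
  -- Both traces are those of the inclusion `ran K → W` and the corestriction `W → ran K`, composed
  -- in the two possible orders.
  have key := LinearMap.trace_comp_comm' (R := ℂ) (Submodule.inclusion hle)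
    ((K : X →ₗ[ℂ] X).rangeRestrict ∘ₗ W.subtype)
  have e1 : Submodule.inclusion hle ∘ₗ (K : X →ₗ[ℂ] X).rangeRestrict ∘ₗ W.subtype =
      ((K : X →ₗ[ℂ] X).codRestrict W h) ∘ₗ W.subtype := rfl
  rw [← e1, ← key]
  rfl

theorem finiteRankTrace_add {K L : X →L[ℂ] X} (hK : FinRank K) (hL : FinRank L) :
    finiteRankTrace (K + L) = finiteRankTrace K + finiteRankTrace L := by
  unfold FinRank at hK hL
  let W := LinearMap.range (K : X →ₗ[ℂ] X) ⊔ LinearMap.range (L : X →ₗ[ℂ] X)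
  have h1 : ∀ x, K x ∈ W := fun x => Submodule.mem_sup_left ⟨x, rfl⟩
  have h2 : ∀ x, L x ∈ W := fun x => Submodule.mem_sup_right ⟨x, rfl⟩
  have h3 : ∀ x, (K + L) x ∈ W := fun x => W.add_mem (h1 x) (h2 x)
  rw [finiteRankTrace_eq h1, finiteRankTrace_eq h2, finiteRankTrace_eq h3, ← map_add]
  rfl

theorem finiteRankTrace_smul {K : X →L[ℂ] X} (hK : FinRank K) (c : ℂ) :
    finiteRankTrace (c • K) = c * finiteRankTrace K := by
  unfold FinRank at hK
  let W := LinearMap.range (K : X →ₗ[ℂ] X)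
  have h1 : ∀ x, K x ∈ W := fun x => ⟨x, rfl⟩
  have h2 : ∀ x, (c • K) x ∈ W := fun x => W.smul_mem c (h1 x)
  rw [finiteRankTrace_eq h1, finiteRankTrace_eq h2, ← smul_eq_mul, ← map_smul]
  rfl

theorem finiteRankTrace_zero : finiteRankTrace (0 : X →L[ℂ] X) = 0 := by
  simpa using finiteRankTrace_smul (FinRank.zero (X := X) (Y := X)) 0

/-- Only `A` needs finite rank: both products live on the finite-dimensional spaces `W = ran A` and
`V = B W`, between which `A` and `B` act. -/
theorem finiteRankTrace_comp_comm {A : X →L[ℂ] Y} (hA : FinRank A) (B : Y →L[ℂ] X) :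
    finiteRankTrace (A ∘L B) = finiteRankTrace (B ∘L A) := by
  unfold FinRank at hA
  let W := LinearMap.range (A : X →ₗ[ℂ] Y)
  let V := W.map (B : Y →ₗ[ℂ] X)
  have h1 : ∀ x, A x ∈ W := fun x => ⟨x, rfl⟩
  have h2 : ∀ x ∈ W, B x ∈ V := fun x hx => ⟨x, hx, rfl⟩
  rw [finiteRankTrace_eq (K := A ∘L B) (W := W) fun y => h1 _,
    finiteRankTrace_eq (K := B ∘L A) (W := V) fun y => h2 _ (h1 y)]
  exact LinearMap.trace_comp_comm' (R := ℂ)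
    ((B : Y →ₗ[ℂ] X).restrict h2)
    (((A : X →ₗ[ℂ] Y).codRestrict W h1) ∘ₗ V.subtype)

end Trace

/-! ### Calculus of finitely meromorphic operator functions. -/

section Meromorphic

variable {X Y Z : Type*} [NormedAddCommGroup X] [NormedSpace ℂ X] [NormedAddCommGroup Y]
  [NormedSpace ℂ Y] [NormedAddCommGroup Z] [NormedSpace ℂ Z]

/-- Finitely meromorphic operator functions at `z₀`, as the smallest class that contains the
analytic functions and the finite rank poles and is closed under sums. -/
inductive FinMero (z₀ : ℂ) : (ℂ → X →L[ℂ] Y) → Prop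
  | analytic {f : ℂ → X →L[ℂ] Y} (hf : AnalyticAt ℂ f z₀) : FinMero z₀ f
  | pole (k : ℕ) {A : X →L[ℂ] Y} (hA : FinRank A) : FinMero z₀ fun z => ((z - z₀) ^ k)⁻¹ • A
  | add {f g : ℂ → X →L[ℂ] Y} (hf : FinMero z₀ f) (hg : FinMero z₀ g) :
      FinMero z₀ fun z => f z + g z
  | congr {f g : ℂ → X →L[ℂ] Y} (hf : FinMero z₀ f) (h : f =ᶠ[𝓝[≠] z₀] g) : FinMero z₀ g

variable {z₀ : ℂ}

theorem analyticAt_clm_comp {f : ℂ → Y →L[ℂ] Z} {g : ℂ → X →L[ℂ] Y} {z₀ : ℂ}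
    (hf : AnalyticAt ℂ f z₀) (hg : AnalyticAt ℂ g z₀) :
    AnalyticAt ℂ (fun z => f z ∘L g z) z₀ :=
  ((ContinuousLinearMap.compL ℂ X Y Z).analyticAt_bilinear (f z₀, g z₀)).comp₂ hf hg

/-- An analytic function is its value plus `(z - z₀)` times an analytic function. -/
theorem exists_analyticAt_eq_add_smul {E : Type*} [NormedAddCommGroup E] [NormedSpace ℂ E]
    {f : ℂ → E} (hf : AnalyticAt ℂ f z₀) :
    ∃ g : ℂ → E, AnalyticAt ℂ g z₀ ∧ ∀ z, f z = f z₀ + (z - z₀) • g z := by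
  obtain ⟨p, hp⟩ := hf
  refine ⟨dslope f z₀, ⟨_, hp.has_fpower_series_dslope_fslope⟩, fun z => ?_⟩
  rw [sub_smul_dslope]
  abel

theorem pow_succ_inv_mul (z : ℂ) (hz : z ≠ z₀) (k : ℕ) :
    ((z - z₀) ^ (k + 1))⁻¹ * (z - z₀) = ((z - z₀) ^ k)⁻¹ := by
  have : z - z₀ ≠ 0 := sub_ne_zero.mpr hz
  rw [pow_succ, mul_inv, mul_assoc, inv_mul_cancel₀ this, mul_one]

/-- Induction on the pole order: the value of `f` at `z₀` contributes a finite rank pole, and the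
remainder `(z - z₀) g` lowers the order by one. -/
theorem FinMero.analytic_comp_pole {f : ℂ → Y →L[ℂ] Z} (hf : AnalyticAt ℂ f z₀) (k : ℕ)
    {A : X →L[ℂ] Y} (hA : FinRank A) :
    FinMero z₀ fun z => f z ∘L (((z - z₀) ^ k)⁻¹ • A) := by
  induction k generalizing f with
  | zero =>
    refine .analytic ?_
    simpa using analyticAt_clm_comp hf analyticAt_const
  | succ k ih =>
    obtain ⟨g, hg, hfg⟩ := exists_analyticAt_eq_add_smul hf
    refine .congr (.add (.pole (k + 1) (hA.comp_left (f z₀))) (ih hg)) ?_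
    filter_upwards [self_mem_nhdsWithin] with z hz
    rw [hfg z, ← pow_succ_inv_mul z hz k]
    ext x
    simp [smul_smul]

theorem FinMero.pole_comp_analytic {f : ℂ → X →L[ℂ] Y} (hf : AnalyticAt ℂ f z₀) (k : ℕ)
    {A : Y →L[ℂ] Z} (hA : FinRank A) :
    FinMero z₀ fun z => (((z - z₀) ^ k)⁻¹ • A) ∘L f z := by
  induction k generalizing f with
  | zero =>
    refine .analytic ?_
    simpa using analyticAt_clm_comp analyticAt_const hf
  | succ k ih =>
    obtain ⟨g, hg, hfg⟩ := exists_analyticAt_eq_add_smul hf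
    refine .congr (.add (.pole (k + 1) (hA.comp_right (f z₀))) (ih hg)) ?_
    filter_upwards [self_mem_nhdsWithin] with z hz
    rw [hfg z, ← pow_succ_inv_mul z hz k]
    ext x
    simp [smul_smul, mul_comm]

theorem FinMero.comp {f : ℂ → Y →L[ℂ] Z} {g : ℂ → X →L[ℂ] Y} (hf : FinMero z₀ f)
    (hg : FinMero z₀ g) : FinMero z₀ fun z => f z ∘L g z := by
  induction hf with
  | @analytic f hf =>
    induction hg with
    | analytic hg => exact .analytic (analyticAt_clm_comp hf hg)
    | pole k hA => exact .analytic_comp_pole hf k hA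
    | add _ _ h1 h2 => exact .congr (.add h1 h2) (.of_forall fun z => by simp)
    | congr _ h h1 => exact .congr h1 (h.mono fun z hz => by simp [hz])
  | @pole k A hA =>
    induction hg with
    | analytic hg => exact .pole_comp_analytic hg k hA
    | @pole l B hB =>
      refine .congr (.pole (k + l) (hA.comp_right B)) (.of_forall fun z => ?_)
      ext x
      simp [pow_add, smul_smul, mul_comm]
    | add _ _ h1 h2 => exact .congr (.add h1 h2) (.of_forall fun z => by simp)
    | congr _ h h1 => exact .congr h1 (h.mono fun z hz => by simp [hz])
  | add _ _ h1 h2 => exact .congr (.add h1 h2) (.of_forall fun z => by simp)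
  | congr _ h h1 => exact .congr h1 (h.mono fun z hz => by simp [hz])

theorem FinMero.neg {f : ℂ → X →L[ℂ] Y} (hf : FinMero z₀ f) : FinMero z₀ fun z => -f z := by
  refine .congr (.comp (.analytic (analyticAt_const (v := -ContinuousLinearMap.id ℂ Y))) hf)
    (.of_forall fun z => ?_)
  ext x
  simp

theorem FinMero.sub {f g : ℂ → X →L[ℂ] Y} (hf : FinMero z₀ f) (hg : FinMero z₀ g) :
    FinMero z₀ fun z => f z - g z :=
  .congr (.add hf hg.neg) (.of_forall fun z => by simp [sub_eq_add_neg])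

theorem FinMero.smul {f : ℂ → X →L[ℂ] Y} (hf : FinMero z₀ f) {c : ℂ → ℂ}
    (hc : AnalyticAt ℂ c z₀) : FinMero z₀ fun z => c z • f z := by
  refine .congr (.comp (.analytic (hc.smul (analyticAt_const (v := ContinuousLinearMap.id ℂ Y))))
    hf) (.of_forall fun z => ?_)
  ext x
  simp

theorem FinMero.finitelyMeromorphicAt {G : Type*} [NormedAddCommGroup G] [InnerProductSpace ℂ G]
    {f : ℂ → G →L[ℂ] G} (hf : FinMero z₀ f) : FinitelyMeromorphicAt f z₀ := by
  induction hf with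
  | @analytic f hf =>
    exact ⟨0, 0, f, fun k => FinRank.zero, hf, .of_forall fun z => by simp⟩
  | @pole k A hA =>
    -- Principal parts start at order `1`, so a pole of order `0` is a constant and belongs to the
    -- analytic part.
    rcases Nat.eq_zero_or_pos k with rfl | hk
    · exact ⟨0, 0, fun _ => A, fun k => FinRank.zero, analyticAt_const,
        .of_forall fun z => by simp⟩
    · refine ⟨k, fun j => if j = k then A else 0, 0, fun j => ?_, analyticAt_const,
        .of_forall fun z => ?_⟩
      · dsimp only
        split_ifs
        exacts [hA, FinRank.zero]
      · rw [Finset.sum_eq_single_of_mem k (Finset.mem_Icc.mpr ⟨hk, le_rfl⟩)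
          (fun j _ hj => by simp [hj])]
        simp
  | @add f g _ _ h1 h2 =>
    obtain ⟨N, A, a, hA, ha, hNA⟩ := h1
    obtain ⟨M, B, b, hB, hb, hMB⟩ := h2
    refine ⟨max N M, fun k => (if k ≤ N then A k else 0) + (if k ≤ M then B k else 0),
      fun z => a z + b z, fun k => ?_, ha.add hb, ?_⟩
    · refine FinRank.add ?_ ?_ <;> split_ifs
      exacts [hA k, FinRank.zero, hB k, FinRank.zero]
    · have aux : ∀ (n m : ℕ) (_ : n ≤ m) (C : ℕ → G →L[ℂ] G) (z : ℂ),
          ∑ k ∈ Finset.Icc 1 m, ((z - z₀) ^ k)⁻¹ • (if k ≤ n then C k else 0) =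
            ∑ k ∈ Finset.Icc 1 n, ((z - z₀) ^ k)⁻¹ • C k := by
        intro n m hnm C z
        rw [← Finset.sum_subset (Finset.Icc_subset_Icc_right hnm)]
        · exact Finset.sum_congr rfl fun k hk => by rw [if_pos (Finset.mem_Icc.mp hk).2]
        · intro k hk hk'
          rw [if_neg, smul_zero]
          intro hkn
          exact hk' (Finset.mem_Icc.mpr ⟨(Finset.mem_Icc.mp hk).1, hkn⟩)
      filter_upwards [hNA, hMB] with z h1 h2
      simp only [smul_add, Finset.sum_add_distrib]
      rw [aux N _ (le_max_left N M), aux M _ (le_max_right N M), h1, h2]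
      abel
  | congr _ h h1 =>
    obtain ⟨N, A, a, hA, ha, hNA⟩ := h1
    refine ⟨N, A, a, hA, ha, ?_⟩
    filter_upwards [h, hNA] with z h1 h2
    rw [← h1, h2]

end Meromorphic

/-! ### Circle integrals and cyclicity of the trace under the integral. -/

section CircleIntegral

theorem eventually_forall_sphere {z₀ : ℂ} {p : ℂ → Prop} (h : ∀ᶠ z in 𝓝[≠] z₀, p z) :
    ∀ᶠ ε in 𝓝[>] (0 : ℝ), ∀ z ∈ Metric.sphere z₀ ε, p z := by
  rw [eventually_nhdsWithin_iff, Metric.eventually_nhds_iff] at h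
  obtain ⟨r, hr, hp⟩ := h
  filter_upwards [Ioo_mem_nhdsGT hr] with ε hε z hz
  rw [mem_sphere_iff_norm] at hz
  refine hp (by rw [dist_eq_norm, hz]; exact hε.2) ?_
  rintro rfl
  simp at hz
  exact hε.1.ne hz

variable {E F : Type*} [NormedAddCommGroup E] [NormedSpace ℂ E]
  [NormedAddCommGroup F] [NormedSpace ℂ F]

theorem clm_circleIntegral [CompleteSpace E] [CompleteSpace F] (L : E →L[ℂ] F)
    {f : ℂ → E} {c : ℂ} {R : ℝ}
    (hf : CircleIntegrable f c R) :
    (∮ z in C(c, R), L (f z)) = L (∮ z in C(c, R), f z) := by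
  simp only [circleIntegral, ← map_smul]
  exact L.intervalIntegral_comp_comm hf.out

theorem clm_circleIntegrable (L : E →L[ℂ] F) {f : ℂ → E} {c : ℂ} {R : ℝ}
    (hf : CircleIntegrable f c R) : CircleIntegrable (fun z => L (f z)) c R := by
  exact ⟨L.integrable_comp hf.1, L.integrable_comp hf.2⟩

/-- Circle integrals of a function analytic on a punctured disc do not depend on the radius. -/
theorem circleIntegral_radius_independent {f : ℂ → E} {z₀ : ℂ} {r : ℝ}
    (hf : ∀ z ∈ Metric.ball z₀ r \ {z₀}, AnalyticAt ℂ f z) {δ ε : ℝ} (hδ : 0 < δ) (hδε : δ ≤ ε)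
    (hε : ε < r) : (∮ z in C(z₀, ε), f z) = ∮ z in C(z₀, δ), f z := by
  have hsub : Metric.closedBall z₀ ε \ Metric.ball z₀ δ ⊆ Metric.ball z₀ r \ {z₀} := by
    rintro z ⟨h1, h2⟩
    refine ⟨Metric.closedBall_subset_ball hε h1, ?_⟩
    rintro rfl
    exact h2 (Metric.mem_ball_self hδ)
  refine Complex.circleIntegral_eq_of_differentiable_on_annulus_off_countable hδ hδε
    Set.countable_empty (fun z hz => (hf z (hsub hz)).continuousAt.continuousWithinAt) ?_
  rintro z ⟨⟨h1, h2⟩, -⟩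
  exact (hf z (hsub ⟨Metric.ball_subset_closedBall h1,
    fun h => h2 (Metric.ball_subset_closedBall h)⟩)).differentiableAt

variable {X Y : Type*} [NormedAddCommGroup X] [InnerProductSpace ℂ X] [CompleteSpace X]
  [NormedAddCommGroup Y] [InnerProductSpace ℂ Y] [CompleteSpace Y]

/-- The circle integrals over `C(z₀;ε)` of `f g` and `g f` exist, have finite rank and the same
trace. -/
def TraceSymm (z₀ : ℂ) (ε : ℝ) (f : ℂ → X →L[ℂ] Y) (g : ℂ → Y →L[ℂ] X) : Prop :=
  CircleIntegrable (fun z => f z ∘L g z) z₀ ε ∧ CircleIntegrable (fun z => g z ∘L f z) z₀ ε ∧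
  FinRank (∮ z in C(z₀, ε), f z ∘L g z) ∧ FinRank (∮ z in C(z₀, ε), g z ∘L f z) ∧
  finiteRankTrace (∮ z in C(z₀, ε), f z ∘L g z) = finiteRankTrace (∮ z in C(z₀, ε), g z ∘L f z)

theorem TraceSymm.symm {z₀ : ℂ} {ε : ℝ} {f : ℂ → X →L[ℂ] Y} {g : ℂ → Y →L[ℂ] X}
    (h : TraceSymm z₀ ε f g) : TraceSymm z₀ ε g f :=
  ⟨h.2.1, h.1, h.2.2.2.1, h.2.2.1, h.2.2.2.2.symm⟩

theorem TraceSymm.add {z₀ : ℂ} {ε : ℝ} {f₁ f₂ : ℂ → X →L[ℂ] Y} {g : ℂ → Y →L[ℂ] X}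
    (h₁ : TraceSymm z₀ ε f₁ g) (h₂ : TraceSymm z₀ ε f₂ g) :
    TraceSymm z₀ ε (fun z => f₁ z + f₂ z) g := by
  obtain ⟨a1, a2, a3, a4, a5⟩ := h₁
  obtain ⟨b1, b2, b3, b4, b5⟩ := h₂
  unfold TraceSymm
  simp only [ContinuousLinearMap.add_comp, ContinuousLinearMap.comp_add]
  rw [circleIntegral.integral_add a1 b1, circleIntegral.integral_add a2 b2,
    finiteRankTrace_add a3 b3, finiteRankTrace_add a4 b4, a5, b5]
  exact ⟨a1.add b1, a2.add b2, a3.add b3, a4.add b4, rfl⟩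

theorem TraceSymm.congr {z₀ : ℂ} {ε : ℝ} (hε : 0 ≤ ε) {f₁ f₂ : ℂ → X →L[ℂ] Y}
    {g : ℂ → Y →L[ℂ] X} (h₁ : TraceSymm z₀ ε f₁ g)
    (h : ∀ z ∈ Metric.sphere z₀ ε, f₁ z = f₂ z) : TraceSymm z₀ ε f₂ g := by
  obtain ⟨a1, a2, a3, a4, a5⟩ := h₁
  have e1 : Set.EqOn (fun z => f₁ z ∘L g z) (fun z => f₂ z ∘L g z) (Metric.sphere z₀ ε) :=
    fun z hz => by simp [h z hz]
  have e2 : Set.EqOn (fun z => g z ∘L f₁ z) (fun z => g z ∘L f₂ z) (Metric.sphere z₀ ε) :=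
    fun z hz => by simp [h z hz]
  rw [circleIntegral.integral_congr hε e1] at a3 a5
  rw [circleIntegral.integral_congr hε e2] at a4 a5
  rw [← abs_of_nonneg hε] at e1 e2
  exact ⟨(circleIntegrable_congr e1).mp a1, (circleIntegrable_congr e2).mp a2, a3, a4, a5⟩

theorem continuousOn_sphere_pow_inv {z₀ : ℂ} {ε : ℝ} (hε : 0 < ε) (k : ℕ) :
    ContinuousOn (fun z : ℂ => ((z - z₀) ^ k)⁻¹) (Metric.sphere z₀ ε) := by
  refine ContinuousOn.inv₀ (by fun_prop) fun z hz => pow_ne_zero _ (sub_ne_zero.mpr ?_)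
  rintro rfl
  simp at hz
  exact hε.ne hz

/-- The constant `A` comes out of both integrals, which become one operator composed with `A` on
either side. -/
theorem TraceSymm.of_pole {z₀ : ℂ} {ε : ℝ} (hε : 0 < ε) {f : ℂ → X →L[ℂ] Y}
    (hf : ContinuousOn f (Metric.sphere z₀ ε)) (k : ℕ) {A : Y →L[ℂ] X} (hA : FinRank A) :
    TraceSymm z₀ ε f fun z => ((z - z₀) ^ k)⁻¹ • A := by
  let F : ℂ → X →L[ℂ] Y := fun z => ((z - z₀) ^ k)⁻¹ • f z
  have hF : CircleIntegrable F z₀ ε := by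
    exact ContinuousOn.circleIntegrable hε.le ((continuousOn_sphere_pow_inv hε k).smul hf)
  let L := (ContinuousLinearMap.compL ℂ Y X Y).flip A
  let R := ContinuousLinearMap.compL ℂ X Y X A
  have e1 : (fun z => f z ∘L (((z - z₀) ^ k)⁻¹ • A)) = fun z => L (F z) := by
    funext z
    ext x
    simp [L, F]
  have e2 : (fun z => (((z - z₀) ^ k)⁻¹ • A) ∘L f z) = fun z => R (F z) := by
    funext z
    ext x
    simp [R, F]
  unfold TraceSymm
  rw [e1, e2, clm_circleIntegral L hF, clm_circleIntegral R hF]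
  exact ⟨clm_circleIntegrable L hF, clm_circleIntegrable R hF, hA.comp_left _, hA.comp_right _,
    (finiteRankTrace_comp_comm hA _).symm⟩

theorem eventually_differentiableOn_closedBall [CompleteSpace E] {z₀ : ℂ} {f : ℂ → E}
    (hf : AnalyticAt ℂ f z₀) :
    ∀ᶠ ε in 𝓝[>] (0 : ℝ), DifferentiableOn ℂ f (Metric.closedBall z₀ ε) := by
  have h := hf.eventually_analyticAt
  rw [Metric.eventually_nhds_iff] at h
  obtain ⟨r, hr, hp⟩ := h
  filter_upwards [Ioo_mem_nhdsGT hr] with ε hε z hz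
  exact (hp (lt_of_le_of_lt hz hε.2)).differentiableAt.differentiableWithinAt

theorem circleIntegral_eq_zero_of_differentiableOn {z₀ : ℂ} {ε : ℝ} (hε : 0 ≤ ε) {f : ℂ → E}
    (hf : DifferentiableOn ℂ f (Metric.closedBall z₀ ε)) : (∮ z in C(z₀, ε), f z) = 0 :=
  (hf.mono Metric.closure_ball_subset_closedBall).diffContOnCl.circleIntegral_eq_zero hε

/-- The products need not have finite rank pointwise, so the trace cannot be taken inside the
integral. By bilinearity it suffices to treat two analytic factors, where Cauchy's theorem gives
zero, and pairs with a finite rank pole, covered by `TraceSymm.of_pole`. -/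
theorem FinMero.traceSymm {z₀ : ℂ} {f : ℂ → X →L[ℂ] Y} {g : ℂ → Y →L[ℂ] X}
    (hf : FinMero z₀ f) (hg : FinMero z₀ g) : ∀ᶠ ε in 𝓝[>] (0 : ℝ), TraceSymm z₀ ε f g := by
  induction hf with
  | @analytic f hf =>
    induction hg with
    | @analytic g hg =>
      filter_upwards [self_mem_nhdsWithin,
        eventually_differentiableOn_closedBall (analyticAt_clm_comp hf hg),
        eventually_differentiableOn_closedBall (analyticAt_clm_comp hg hf)] with ε hε h1 h2
      have hε' : 0 ≤ ε := le_of_lt hε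
      unfold TraceSymm
      rw [circleIntegral_eq_zero_of_differentiableOn hε' h1,
        circleIntegral_eq_zero_of_differentiableOn hε' h2, finiteRankTrace_zero,
        finiteRankTrace_zero]
      exact ⟨(h1.continuousOn.mono Metric.sphere_subset_closedBall).circleIntegrable hε',
        (h2.continuousOn.mono Metric.sphere_subset_closedBall).circleIntegrable hε',
        FinRank.zero, FinRank.zero, rfl⟩
    | pole k hA =>
      filter_upwards [self_mem_nhdsWithin, eventually_differentiableOn_closedBall hf]
        with ε hε h1
      exact TraceSymm.of_pole hε (h1.continuousOn.mono Metric.sphere_subset_closedBall) k hA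
    | add _ _ h1 h2 =>
      filter_upwards [h1, h2] with ε h1 h2 using (h1.symm.add h2.symm).symm
    | congr _ h h1 =>
      filter_upwards [self_mem_nhdsWithin, h1, eventually_forall_sphere h] with ε hε h1 h
      exact (h1.symm.congr (le_of_lt hε) h).symm
  | @pole k A hA =>
    induction hg with
    | analytic hg =>
      filter_upwards [self_mem_nhdsWithin, eventually_differentiableOn_closedBall hg]
        with ε hε h1
      exact (TraceSymm.of_pole hε
        (h1.continuousOn.mono Metric.sphere_subset_closedBall) k hA).symm
    | @pole l B hB =>
      filter_upwards [self_mem_nhdsWithin] with ε hε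
      exact TraceSymm.of_pole hε
        ((continuousOn_sphere_pow_inv hε k).smul continuousOn_const) l hB
    | add _ _ h1 h2 =>
      filter_upwards [h1, h2] with ε h1 h2 using (h1.symm.add h2.symm).symm
    | congr _ h h1 =>
      filter_upwards [self_mem_nhdsWithin, h1, eventually_forall_sphere h] with ε hε h1 h
      exact (h1.symm.congr (le_of_lt hε) h).symm
  | add _ _ h1 h2 => filter_upwards [h1, h2] with ε h1 h2 using h1.add h2
  | congr _ h h1 =>
    filter_upwards [self_mem_nhdsWithin, h1, eventually_forall_sphere h] with ε hε h1 h
    exact h1.congr (le_of_lt hε) h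

end CircleIntegral

/-! ### The resolvent of an unbounded operator and its analyticity. -/

section Resolvent

variable {H : Type*} [NormedAddCommGroup H] [InnerProductSpace ℂ H] {T : H →ₗ.[ℂ] H}

theorem IsBoundedInverse.eq {R R' : H →L[ℂ] H} (h : IsBoundedInverse T R)
    (h' : IsBoundedInverse T R') : R = R' := by
  ext y
  obtain ⟨hy, e⟩ := h.1 y
  have := h'.2 ⟨R y, hy⟩
  rw [e] at this
  exact this.symm

theorem isBoundedInverse_boundedInverse (h : BoundedlyInvertible T) :
    IsBoundedInverse T (boundedInverse T) := by
  unfold boundedInverse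
  rw [dif_pos h]
  exact h.choose_spec

theorem IsBoundedInverse.boundedInverse_eq {R : H →L[ℂ] H} (h : IsBoundedInverse T R) :
    boundedInverse T = R :=
  (isBoundedInverse_boundedInverse ⟨R, h⟩).eq h

theorem resolventOp_mem {z : ℂ} (hz : z ∈ resSet T) (y : H) :
    ∃ h : resolventOp T z y ∈ T.domain,
      T ⟨resolventOp T z y, h⟩ = y + z • resolventOp T z y := by
  obtain ⟨h, e⟩ := (isBoundedInverse_boundedInverse hz).1 y
  exact ⟨h, sub_eq_iff_eq_add.mp e⟩

theorem resolventOp_apply_sub {z : ℂ} (hz : z ∈ resSet T) (x : T.domain) :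
    resolventOp T z (T x - z • (x : H)) = x :=
  (isBoundedInverse_boundedInverse hz).2 x

theorem resolventOp_injective {z : ℂ} (hz : z ∈ resSet T) :
    Function.Injective (resolventOp T z) := by
  rw [injective_iff_map_eq_zero]
  intro y hy
  obtain ⟨h, e⟩ := resolventOp_mem hz y
  have h0 : (⟨resolventOp T z y, h⟩ : T.domain) = 0 := Subtype.ext hy
  rw [h0, hy, LinearPMap.map_zero] at e
  simpa using e.symm

/-- The first resolvent identity. -/
theorem resolventOp_sub {z w : ℂ} (hz : z ∈ resSet T) (hw : w ∈ resSet T) :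
    resolventOp T z - resolventOp T w = (z - w) • (resolventOp T z ∘L resolventOp T w) := by
  ext y
  obtain ⟨h, e⟩ := resolventOp_mem hw y
  have h2 := resolventOp_apply_sub hz ⟨resolventOp T w y, h⟩
  rw [e, add_sub_assoc, ← sub_smul, map_add, map_smul] at h2
  simp only [sub_apply, smul_apply,
    ContinuousLinearMap.comp_apply]
  have h3 : resolventOp T w y = resolventOp T z y +
      (w - z) • resolventOp T z (resolventOp T w y) := h2.symm
  nth_rewrite 1 [h3]
  module

theorem resolventOp_comm {z w : ℂ} (hz : z ∈ resSet T) (hw : w ∈ resSet T) :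
    resolventOp T z ∘L resolventOp T w = resolventOp T w ∘L resolventOp T z := by
  rcases eq_or_ne z w with rfl | hne
  · rfl
  have h : (z - w) • (resolventOp T z ∘L resolventOp T w) =
      (z - w) • (resolventOp T w ∘L resolventOp T z) := by
    rw [← resolventOp_sub hz hw, ← neg_sub w z, neg_smul, ← resolventOp_sub hw hz, neg_sub]
  exact smul_right_injective _ (sub_ne_zero.mpr hne) h

/-- On `dom T` one has `T - z = (1 - (z - w)(T - w)⁻¹)(T - w)`; `v` inverts the first factor. -/
theorem isBoundedInverse_neumann {z w : ℂ} (hw : w ∈ resSet T) {v : H →L[ℂ] H}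
    (h₁ : (1 - (z - w) • resolventOp T w) * v = 1) (h₂ : v * (1 - (z - w) • resolventOp T w) = 1) :
    IsBoundedInverse (shift T z) (resolventOp T w ∘L v) := by
  constructor
  · intro y
    obtain ⟨h, e⟩ := resolventOp_mem hw (v y)
    refine ⟨h, ?_⟩
    have h1 := DFunLike.congr_fun h₁ y
    simp only [mul_apply_eq_comp, sub_apply,
      one_apply_eq_self, smul_apply] at h1
    change T ⟨resolventOp T w (v y), h⟩ - z • resolventOp T w (v y) = y
    rw [e]
    refine Eq.trans ?_ h1
    module
  · intro x
    change resolventOp T w (v (T x - z • (x : H))) = x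
    have h1 := resolventOp_apply_sub hw x
    have h2 := DFunLike.congr_fun h₂ (T x - w • (x : H))
    simp only [mul_apply_eq_comp, sub_apply,
      one_apply_eq_self, smul_apply] at h2
    rw [h1] at h2
    have e : T x - z • (x : H) = T x - w • (x : H) - (z - w) • (x : H) := by module
    rw [e, h2, h1]

theorem mem_kerPow_succ {z : ℂ} {n : ℕ} {x : H} :
    x ∈ kerPow T z (n + 1) ↔ ∃ h : x ∈ T.domain, T ⟨x, h⟩ - z • x ∈ kerPow T z n := by
  constructor
  · rintro ⟨y, hy, rfl⟩
    exact ⟨y.2, hy⟩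
  · rintro ⟨h, h'⟩
    exact ⟨⟨x, h⟩, h', rfl⟩

variable [CompleteSpace H]

theorem exists_analytic_boundedInverse_shift {w : ℂ} (hw : w ∈ resSet T) :
    ∃ F : ℂ → H →L[ℂ] H, AnalyticAt ℂ F w ∧
      ∀ᶠ z in 𝓝 w, IsBoundedInverse (shift T z) (F z) := by
  let u : ℂ → H →L[ℂ] H := fun z => 1 - (z - w) • resolventOp T w
  have hu : AnalyticAt ℂ u w := by fun_prop
  have hu1 : u w = 1 := by simp [u]
  have hinv : AnalyticAt ℂ (fun z => Ring.inverse (u z)) w := by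
    refine AnalyticAt.comp (g := Ring.inverse) ?_ hu
    rw [hu1]
    exact analyticAt_inverse (1 : (H →L[ℂ] H)ˣ)
  refine ⟨fun z => resolventOp T w ∘L Ring.inverse (u z),
    analyticAt_clm_comp analyticAt_const hinv, ?_⟩
  have hunit : ∀ᶠ z in 𝓝 w, IsUnit (u z) := by
    refine hu.continuousAt.eventually (p := IsUnit) ?_
    rw [hu1]
    exact Units.nhds (1 : (H →L[ℂ] H)ˣ)
  filter_upwards [hunit] with z hz
  exact isBoundedInverse_neumann hw (Ring.mul_inverse_cancel _ hz) (Ring.inverse_mul_cancel _ hz)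

theorem resolventOp_analyticAt {w : ℂ} (hw : w ∈ resSet T) :
    AnalyticAt ℂ (resolventOp T) w := by
  obtain ⟨F, hF, h⟩ := exists_analytic_boundedInverse_shift hw
  exact hF.congr (h.mono fun z hz => hz.boundedInverse_eq.symm)

theorem isOpen_resSet : IsOpen (resSet T) := by
  rw [isOpen_iff_mem_nhds]
  intro w hw
  obtain ⟨F, -, h⟩ := exists_analytic_boundedInverse_shift hw
  exact h.mono fun z hz => ⟨_, hz⟩

end Resolvent

/-! ### Riesz projections, algebraic eigenspaces and the pole of the resolvent. -/

section Riesz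

variable {H : Type*} [NormedAddCommGroup H] [InnerProductSpace ℂ H] [CompleteSpace H]
  {T : H →ₗ.[ℂ] H} {z₀ : ℂ} {r ε : ℝ}

theorem sphere_subset_punctured (hε : 0 < ε) (hεr : ε < r) :
    Metric.sphere z₀ ε ⊆ Metric.ball z₀ r \ {z₀} := by
  intro z hz
  refine ⟨Metric.mem_ball.mpr (hz.le.trans_lt hεr), ?_⟩
  rintro rfl
  simp at hz
  exact hε.ne hz

theorem resolventOp_circleIntegrable (hr : Metric.ball z₀ r \ {z₀} ⊆ resSet T) (hε : 0 < ε)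
    (hεr : ε < r) : CircleIntegrable (resolventOp T) z₀ ε :=
  ContinuousOn.circleIntegrable hε.le fun _ hz =>
    (resolventOp_analyticAt (hr (sphere_subset_punctured hε hεr hz))).continuousAt.continuousWithinAt

theorem two_pi_I_smul_rieszProjection (T : H →ₗ.[ℂ] H) (z₀ : ℂ) (ε : ℝ) :
    (∮ ζ in C(z₀, ε), resolventOp T ζ) =
      -((2 * Real.pi * Complex.I : ℂ) • rieszProjection T z₀ ε) := by
  rw [rieszProjection, smul_neg, neg_neg, smul_inv_smul₀ Complex.two_pi_I_ne_zero]

/-- The part of the resolvent that is regular at `z₀`. -/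
noncomputable def regularPart (T : H →ₗ.[ℂ] H) (z₀ : ℂ) (ε : ℝ) (z : ℂ) : H →L[ℂ] H :=
  (2 * Real.pi * Complex.I : ℂ)⁻¹ • ∮ ζ in C(z₀, ε), (ζ - z)⁻¹ • resolventOp T ζ

/-- A Cauchy integral is analytic inside the circle as soon as the density is integrable on it, so
the singularity of the resolvent at `z₀` does no harm. -/
theorem regularPart_analyticAt (hr : Metric.ball z₀ r \ {z₀} ⊆ resSet T) (hε : 0 < ε)
    (hεr : ε < r) {z : ℂ} (hz : z ∈ Metric.ball z₀ ε) :
    AnalyticAt ℂ (regularPart T z₀ ε) z := by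
  lift ε to NNReal using hε.le
  have h := hasFPowerSeriesOn_cauchy_integral (resolventOp_circleIntegrable hr hε hεr)
    (by exact_mod_cast hε)
  refine h.analyticOnNhd z ?_
  simpa using hz

/-- By the resolvent identity the integrand of the regular part is `(ζ - z)⁻¹ R(z) + R(z) R(ζ)`,
where `R` is the resolvent. The first term integrates to `R(z)`, the second to `-R(z) P`, up to the
factor `2πi`. -/
theorem resolventOp_sub_comp_rieszProjection (hr : Metric.ball z₀ r \ {z₀} ⊆ resSet T)
    (hε : 0 < ε) (hεr : ε < r) {z : ℂ} (hz : z ∈ Metric.ball z₀ ε) (hz0 : z ≠ z₀) :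
    resolventOp T z - resolventOp T z ∘L rieszProjection T z₀ ε = regularPart T z₀ ε z := by
  have hzr : z ∈ resSet T := hr ⟨Metric.ball_subset_ball hεr.le hz, hz0⟩
  have hne : ∀ ζ ∈ Metric.sphere z₀ ε, ζ - z ≠ 0 := by
    intro ζ hζ h
    rw [sub_eq_zero] at h
    subst h
    exact (Metric.mem_ball.mp hz).ne hζ
  have hcongr : Set.EqOn (fun ζ => (ζ - z)⁻¹ • resolventOp T ζ)
      (fun ζ => (ζ - z)⁻¹ • resolventOp T z +
        ContinuousLinearMap.compL ℂ H H H (resolventOp T z) (resolventOp T ζ))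
      (Metric.sphere z₀ ε) := by
    intro ζ hζ
    have hζr := hr (sphere_subset_punctured hε hεr hζ)
    have e := resolventOp_sub hζr hzr
    rw [resolventOp_comm hζr hzr, sub_eq_iff_eq_add] at e
    have e2 : (ζ - z)⁻¹ • resolventOp T ζ = (ζ - z)⁻¹ •
        ((ζ - z) • (resolventOp T z ∘L resolventOp T ζ) + resolventOp T z) := by rw [← e]
    dsimp only
    rw [e2, smul_add, smul_smul, inv_mul_cancel₀ (hne ζ hζ), one_smul, add_comm]
    rfl
  have hint := resolventOp_circleIntegrable hr hε hεr
  have hint1 : CircleIntegrable (fun ζ => (ζ - z)⁻¹ • resolventOp T z) z₀ ε := by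
    refine ContinuousOn.circleIntegrable hε.le ?_
    have h : ContinuousOn (fun ζ => (ζ - z)⁻¹) (Metric.sphere z₀ ε) :=
      ContinuousOn.inv₀ (by fun_prop) hne
    exact h.smul continuousOn_const
  rw [regularPart, circleIntegral.integral_congr hε.le hcongr,
    circleIntegral.integral_add hint1 (clm_circleIntegrable _ hint),
    circleIntegral.integral_smul_const, circleIntegral.integral_sub_inv_of_mem_ball hz,
    clm_circleIntegral _ hint, two_pi_I_smul_rieszProjection, map_neg, map_smul, smul_add,
    smul_neg, inv_smul_smul₀ Complex.two_pi_I_ne_zero, inv_smul_smul₀ Complex.two_pi_I_ne_zero,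
    sub_eq_add_neg]
  rfl

theorem rieszProjection_comm (hr : Metric.ball z₀ r \ {z₀} ⊆ resSet T)
    (hε : 0 < ε) (hεr : ε < r) {z : ℂ} (hz : z ∈ resSet T) :
    resolventOp T z ∘L rieszProjection T z₀ ε = rieszProjection T z₀ ε ∘L resolventOp T z := by
  have hint := resolventOp_circleIntegrable hr hε hεr
  have h1 := clm_circleIntegral (ContinuousLinearMap.compL ℂ H H H (resolventOp T z)) hint
  have h2 := clm_circleIntegral ((ContinuousLinearMap.compL ℂ H H H).flip (resolventOp T z)) hint
  have h3 : (∮ ζ in C(z₀, ε), ContinuousLinearMap.compL ℂ H H H (resolventOp T z)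
      (resolventOp T ζ)) = ∮ ζ in C(z₀, ε),
        (ContinuousLinearMap.compL ℂ H H H).flip (resolventOp T z) (resolventOp T ζ) :=
    circleIntegral.integral_congr hε.le fun ζ hζ =>
      resolventOp_comm hz (hr (sphere_subset_punctured hε hεr hζ))
  rw [h1, h2] at h3
  simp only [ContinuousLinearMap.compL_apply, ContinuousLinearMap.flip_apply] at h3
  simp only [rieszProjection, ContinuousLinearMap.comp_neg, ContinuousLinearMap.neg_comp,
    ContinuousLinearMap.comp_smul, ContinuousLinearMap.smul_comp, h3]

theorem rieszProjection_radius_independent (hr : Metric.ball z₀ r \ {z₀} ⊆ resSet T) {δ : ℝ}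
    (hδ : 0 < δ) (hδε : δ ≤ ε) (hεr : ε < r) :
    rieszProjection T z₀ ε = rieszProjection T z₀ δ := by
  rw [rieszProjection, rieszProjection, circleIntegral_radius_independent
    (fun z hz => resolventOp_analyticAt (hr hz)) hδ hδε hεr]

/-- Since `R(z)(1 - P)` is the regular part, its integral over a smaller circle vanishes by Cauchy's
theorem, which says `P (1 - P) = 0`. The smaller circle is needed because the decomposition holds
inside the original one; `P` is the same for both radii. -/
theorem rieszProjection_idempotent (hr : Metric.ball z₀ r \ {z₀} ⊆ resSet T)
    (hε : 0 < ε) (hεr : ε < r) :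
    rieszProjection T z₀ ε ∘L rieszProjection T z₀ ε = rieszProjection T z₀ ε := by
  set P := rieszProjection T z₀ ε with hP
  have hδ : 0 < ε / 2 := by positivity
  have hδε : ε / 2 < ε := by linarith
  have hint := resolventOp_circleIntegrable hr hδ (hδε.trans hεr)
  let L := (ContinuousLinearMap.compL ℂ H H H).flip (1 - P)
  have h1 := clm_circleIntegral L hint
  have h2 : (∮ z in C(z₀, ε / 2), L (resolventOp T z)) =
      ∮ z in C(z₀, ε / 2), regularPart T z₀ ε z := by
    refine circleIntegral.integral_congr hδ.le fun z hz => ?_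
    obtain ⟨hzb, hz0⟩ := sphere_subset_punctured hδ hδε hz
    rw [← resolventOp_sub_comp_rieszProjection hr hε hεr hzb hz0]
    ext x
    simp [L, hP]
  have h3 : (∮ z in C(z₀, ε / 2), regularPart T z₀ ε z) = 0 :=
    circleIntegral_eq_zero_of_differentiableOn hδ.le fun z hz =>
      (regularPart_analyticAt hr hε hεr
        (Metric.closedBall_subset_ball hδε hz)).differentiableAt.differentiableWithinAt
  rw [h2, h3, two_pi_I_smul_rieszProjection,
    ← rieszProjection_radius_independent hr hδ hδε.le hεr, ← hP, map_neg, map_smul] at h1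
  have h4 : L P = 0 := by
    have := h1.symm
    rwa [neg_eq_zero, smul_eq_zero_iff_right Complex.two_pi_I_ne_zero] at this
  have h5 : L P = P - P ∘L P := by
    ext x
    simp [L]
  rw [h5, sub_eq_zero] at h4
  exact h4.symm

/-- Over `ℂ` the generalized eigenspaces span, and all but the one at `0` are trivial. -/
theorem isNilpotent_of_hasEigenvalue_eq_zero {V : Type*} [AddCommGroup V] [Module ℂ V]
    [FiniteDimensional ℂ V] (f : Module.End ℂ V) (h : ∀ μ, f.HasEigenvalue μ → μ = 0) :
    f ^ Module.finrank ℂ V = 0 := by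
  have htop : f.maxGenEigenspace 0 = ⊤ := by
    rw [eq_top_iff, ← Module.End.iSup_maxGenEigenspace_eq_top f]
    refine iSup_le fun μ => ?_
    by_cases hμ : μ = 0
    · rw [hμ]
    · have : f.maxGenEigenspace μ = ⊥ := by
        by_contra hne
        have h1 : f.HasUnifEigenvalue μ ⊤ := hne
        exact hμ (h μ (h1.lt zero_lt_one))
      rw [this]
      exact bot_le
  rw [Module.End.maxGenEigenspace_eq_genEigenspace_finrank] at htop
  ext v
  have hv : v ∈ f.genEigenspace 0 (Module.finrank ℂ V) := by rw [htop]; trivial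
  rw [Module.End.mem_genEigenspace_nat] at hv
  simpa using hv

theorem rieszProjection_apply_of_mem_range (hr : Metric.ball z₀ r \ {z₀} ⊆ resSet T)
    (hε : 0 < ε) (hεr : ε < r) {x : H}
    (h : x ∈ LinearMap.range (rieszProjection T z₀ ε : H →ₗ[ℂ] H)) :
    rieszProjection T z₀ ε x = x := by
  obtain ⟨y, rfl⟩ := h
  exact DFunLike.congr_fun (rieszProjection_idempotent hr hε hεr) y

theorem punctured_ball_nonempty (z₀ : ℂ) (hr : 0 < r) : (Metric.ball z₀ r \ {z₀}).Nonempty := by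
  refine ⟨z₀ + (r / 2 : ℝ), ?_, ?_⟩
  · rw [Metric.mem_ball, dist_eq_norm, add_sub_cancel_left, Complex.norm_real,
      Real.norm_of_nonneg (by positivity)]
    linarith
  · simp [hr.ne']

/-- A finite-dimensional range of the Riesz projection is invariant under `T`. -/
theorem mem_range_rieszProjection_invariant (hr : Metric.ball z₀ r \ {z₀} ⊆ resSet T)
    (hε : 0 < ε) (hεr : ε < r) (hfin : FinRank (rieszProjection T z₀ ε)) {x : H}
    (hx : x ∈ LinearMap.range (rieszProjection T z₀ ε : H →ₗ[ℂ] H)) :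
    ∃ h : x ∈ T.domain, T ⟨x, h⟩ ∈ LinearMap.range (rieszProjection T z₀ ε : H →ₗ[ℂ] H) := by
  unfold FinRank at hfin
  set V := LinearMap.range (rieszProjection T z₀ ε : H →ₗ[ℂ] H) with hV
  obtain ⟨w, hw⟩ := punctured_ball_nonempty z₀ (hε.trans hεr)
  have hw' := hr hw
  have hinv : ∀ y ∈ V, (resolventOp T w : H →ₗ[ℂ] H) y ∈ V := by
    rintro _ ⟨y, rfl⟩
    exact ⟨resolventOp T w y, (DFunLike.congr_fun (rieszProjection_comm hr hε hεr hw') y).symm⟩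
  -- The resolvent commutes with the projection, hence acts on `V`. Being injective there it is
  -- onto, so each `x ∈ V` is `(T - w)⁻¹ y` with `y ∈ V`.
  let f : V →ₗ[ℂ] V := (resolventOp T w : H →ₗ[ℂ] H).restrict hinv
  have hinj : Function.Injective f := by
    intro a b hab
    exact Subtype.ext (resolventOp_injective hw' (congrArg Subtype.val hab))
  obtain ⟨y, hy⟩ := LinearMap.injective_iff_surjective.mp hinj ⟨x, hx⟩
  have hyx : resolventOp T w y = x := congrArg Subtype.val hy
  obtain ⟨h, e⟩ := resolventOp_mem hw' (y : H)
  subst hyx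
  refine ⟨h, ?_⟩
  rw [e]
  exact V.add_mem y.2 (V.smul_mem _ hx)

/-- `T` restricted to the range of the Riesz projection has no eigenvalue but `z₀`. -/
theorem eigenvalue_eq_of_mem_range (hr : Metric.ball z₀ r \ {z₀} ⊆ resSet T)
    (hε : 0 < ε) (hεr : ε < r) {x : T.domain}
    (hx : (x : H) ∈ LinearMap.range (rieszProjection T z₀ ε : H →ₗ[ℂ] H)) {μ : ℂ}
    (hμ : T x = μ • (x : H)) (hx0 : (x : H) ≠ 0) : μ = z₀ := by
  by_contra hne
  by_cases hball : μ ∈ Metric.ball z₀ r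
  · have h := resolventOp_apply_sub (hr ⟨hball, hne⟩) x
    rw [hμ, sub_self, map_zero] at h
    exact hx0 h.symm
  -- For `μ` outside the disc, `(T - ζ)⁻¹ x = (μ - ζ)⁻¹ x` is analytic in `ζ`, so the projection
  -- would annihilate `x`, although it fixes `x`.
  have hfar : ∀ ζ ∈ Metric.closedBall z₀ ε, μ - ζ ≠ 0 := by
    intro ζ hζ h
    rw [sub_eq_zero] at h
    subst h
    exact hball (Metric.closedBall_subset_ball hεr hζ)
  have hint := resolventOp_circleIntegrable hr hε hεr
  have h1 := clm_circleIntegral (ContinuousLinearMap.apply ℂ H (x : H)) hint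
  have h2 : (∮ ζ in C(z₀, ε), ContinuousLinearMap.apply ℂ H (x : H) (resolventOp T ζ)) =
      ∮ ζ in C(z₀, ε), (μ - ζ)⁻¹ • (x : H) := by
    refine circleIntegral.integral_congr hε.le fun ζ hζ => ?_
    have h := resolventOp_apply_sub (hr (sphere_subset_punctured hε hεr hζ)) x
    rw [hμ, ← sub_smul, map_smul] at h
    rw [ContinuousLinearMap.apply_apply, eq_inv_smul_iff₀
      (hfar ζ (Metric.sphere_subset_closedBall hζ)), h]
  have h3 : (∮ ζ in C(z₀, ε), (μ - ζ)⁻¹ • (x : H)) = 0 := by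
    refine circleIntegral_eq_zero_of_differentiableOn hε.le fun ζ hζ => ?_
    refine DifferentiableWithinAt.smul_const (DifferentiableWithinAt.inv (by fun_prop)
      (hfar ζ hζ)) _
  rw [h2, h3, two_pi_I_smul_rieszProjection, ContinuousLinearMap.apply_apply,
    neg_apply, smul_apply,
    rieszProjection_apply_of_mem_range hr hε hεr hx] at h1
  have h4 := h1.symm
  rw [neg_eq_zero, smul_eq_zero_iff_right Complex.two_pi_I_ne_zero] at h4
  exact hx0 h4

theorem exists_nilpotent_on_range (hr : Metric.ball z₀ r \ {z₀} ⊆ resSet T)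
    (hε : 0 < ε) (hεr : ε < r) (hfin : FinRank (rieszProjection T z₀ ε)) :
    ∃ N : Module.End ℂ (LinearMap.range (rieszProjection T z₀ ε : H →ₗ[ℂ] H)),
      (∀ x : LinearMap.range (rieszProjection T z₀ ε : H →ₗ[ℂ] H), ∃ h : (x : H) ∈ T.domain,
        (N x : H) = T ⟨x, h⟩ - z₀ • (x : H)) ∧
      ∃ n, N ^ n = 0 := by
  have hfin' := hfin
  unfold FinRank at hfin'
  set V := LinearMap.range (rieszProjection T z₀ ε : H →ₗ[ℂ] H) with hV
  have hle : V ≤ T.domain := fun x hx =>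
    (mem_range_rieszProjection_invariant hr hε hεr hfin hx).1
  have hinv : ∀ x : V, (T.toFun ∘ₗ Submodule.inclusion hle - z₀ • V.subtype) x ∈ V := by
    intro x
    obtain ⟨h, h'⟩ := mem_range_rieszProjection_invariant hr hε hεr hfin x.2
    exact V.sub_mem h' (V.smul_mem _ x.2)
  let N : Module.End ℂ V :=
    (T.toFun ∘ₗ Submodule.inclusion hle - z₀ • V.subtype).codRestrict V hinv
  refine ⟨N, fun x => ⟨hle x.2, rfl⟩, _, isNilpotent_of_hasEigenvalue_eq_zero N ?_⟩
  intro μ hμ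
  obtain ⟨x, hx⟩ := hμ.exists_hasEigenvector
  have h1 : T ⟨x, hle x.2⟩ - z₀ • (x : H) = μ • (x : H) :=
    congrArg Subtype.val (Module.End.mem_eigenspace_iff.mp hx.1)
  have h2 := eigenvalue_eq_of_mem_range hr hε hεr (x := ⟨x, hle x.2⟩) x.2 (μ := μ + z₀)
    (by rw [add_smul, ← h1]; simp) (by simpa using hx.2)
  simpa using h2

/-- Modulo the regular part the resolvent is `R(z) P`. On the range of `P`, with `N = T - z₀`, one
has `(z - z₀) R(z) N^k P = R(z) N^(k+1) P - N^k P`; iterating until `N^n = 0` leaves finitely many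
finite rank poles. -/
theorem resolventOp_finMero (hr : Metric.ball z₀ r \ {z₀} ⊆ resSet T)
    (hε : 0 < ε) (hεr : ε < r) (hfin : FinRank (rieszProjection T z₀ ε)) :
    FinMero z₀ (resolventOp T) := by
  obtain ⟨N, hN, n, hn⟩ := exists_nilpotent_on_range hr hε hεr hfin
  have hfin' := hfin
  unfold FinRank at hfin'
  let V := LinearMap.range (rieszProjection T z₀ ε : H →ₗ[ℂ] H)
  let P := rieszProjection T z₀ ε
  let C : ℕ → H →L[ℂ] H := fun k =>
    (V.subtypeL ∘L LinearMap.toContinuousLinearMap (N ^ k)) ∘L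
      P.codRestrict V (fun x => ⟨x, rfl⟩)
  have hC0 : C 0 = P := by
    ext x
    rfl
  have hCn : C n = 0 := by
    ext x
    simp only [C, hn]
    rfl
  have hCfin : ∀ k, FinRank (C k) := fun k =>
    FinRank.of_forall_mem (W := V) fun x => ((N ^ k) _).2
  have hev : ∀ᶠ z in 𝓝[≠] z₀, z ∈ Metric.ball z₀ ε ∧ z ≠ z₀ := by
    rw [eventually_nhdsWithin_iff]
    filter_upwards [Metric.ball_mem_nhds z₀ hε] with z hz hz0 using ⟨hz, hz0⟩
  have hstep : ∀ k, ∀ z, z ∈ Metric.ball z₀ ε → z ≠ z₀ →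
      (z - z₀) • (resolventOp T z ∘L C k) = resolventOp T z ∘L C (k + 1) - C k := by
    intro k z hz hz0
    have hzr : z ∈ resSet T := hr ⟨Metric.ball_subset_ball hεr.le hz, hz0⟩
    ext x
    let v : V := (N ^ k) (P.codRestrict V (fun x => ⟨x, rfl⟩) x)
    have hv : C k x = v := rfl
    have hv' : C (k + 1) x = N v := by
      simp only [C, pow_succ', v]
      rfl
    obtain ⟨h, e⟩ := hN v
    have h1 := resolventOp_apply_sub hzr ⟨v, h⟩
    have h2 : T ⟨v, h⟩ - z • (v : H) = N v - (z - z₀) • (v : H) := by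
      rw [e]
      module
    rw [h2, map_sub, map_smul] at h1
    simp only [smul_apply, ContinuousLinearMap.comp_apply,
      sub_apply, hv, hv']
    rw [eq_sub_iff_add_eq, add_comm, ← eq_sub_iff_add_eq]
    exact h1.symm
  -- Downward induction on `k` from `n`. The exponent `j` is left free because each step divides
  -- once more by `z - z₀`.
  have hmain : ∀ m k, k + m = n → ∀ j : ℕ,
      FinMero z₀ fun z => ((z - z₀) ^ j)⁻¹ • (resolventOp T z ∘L C k) := by
    intro m
    induction m with
    | zero =>
      rintro k rfl j
      refine .congr (.analytic (analyticAt_const (v := (0 : H →L[ℂ] H)))) (.of_forall fun z => ?_)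
      simp only [add_zero] at hCn
      simp [hCn]
    | succ m ih =>
      intro k hk j
      refine .congr (.sub (ih (k + 1) (by omega) (j + 1)) (.pole (j + 1) (hCfin k))) ?_
      filter_upwards [hev] with z hz
      rw [← smul_sub, ← hstep k z hz.1 hz.2, smul_smul, pow_succ_inv_mul z hz.2]
  have h0 := hmain n 0 (by simp) 0
  refine .congr (.add h0 (.analytic (regularPart_analyticAt hr hε hεr
    (Metric.mem_ball_self hε)))) ?_
  filter_upwards [hev] with z hz
  rw [hC0, ← resolventOp_sub_comp_rieszProjection hr hε hεr hz.1 hz.2]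
  simp [P]

/-- Induction on `n`: `y = (T - z₀) x` is fixed by `P`. Subtracting from `x = R(z) y + (z₀ - z) R(z)
x` its image under `P` leaves `x - P x = (z₀ - z)` times the regular part applied to `x`, which
tends to `0` as `z → z₀`. -/
theorem rieszProjection_apply_of_mem_kerPow (hr : Metric.ball z₀ r \ {z₀} ⊆ resSet T)
    (hε : 0 < ε) (hεr : ε < r) (n : ℕ) :
    ∀ x ∈ kerPow T z₀ n, rieszProjection T z₀ ε x = x := by
  induction n with
  | zero =>
    intro x hx
    have : x = 0 := hx
    simp [this]
  | succ n ih =>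
    intro x hx
    obtain ⟨h, hy⟩ := mem_kerPow_succ.mp hx
    have hPy := ih _ hy
    set P := rieszProjection T z₀ ε with hP
    have key : ∀ᶠ z in 𝓝[≠] z₀, x - P x = (z₀ - z) • regularPart T z₀ ε z x := by
      rw [eventually_nhdsWithin_iff]
      filter_upwards [Metric.ball_mem_nhds z₀ hε] with z hz hz0
      have hzr : z ∈ resSet T := hr ⟨Metric.ball_subset_ball hεr.le hz, hz0⟩
      have h1 := resolventOp_apply_sub hzr ⟨x, h⟩
      have h2 : T ⟨x, h⟩ - z • x = (T ⟨x, h⟩ - z₀ • x) + (z₀ - z) • x := by module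
      simp only [] at h1
      rw [h2, map_add, map_smul] at h1
      have h3 : ∀ y, P (resolventOp T z y) = resolventOp T z (P y) := fun y =>
        (DFunLike.congr_fun (rieszProjection_comm hr hε hεr hzr) y).symm
      have h4 := congrArg P h1
      rw [map_add, map_smul, h3, h3, hPy] at h4
      rw [← resolventOp_sub_comp_rieszProjection hr hε hεr hz hz0, ← hP]
      simp only [sub_apply, ContinuousLinearMap.comp_apply]
      have h5 : ∀ a b c d e : H, a + (z₀ - z) • b = c → a + (z₀ - z) • d = e →
          c - e = (z₀ - z) • (b - d) := by
        rintro a b c d e rfl rfl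
        module
      exact h5 _ _ _ _ _ h1 h4
    have hlim : Tendsto (fun z => (z₀ - z) • regularPart T z₀ ε z x) (𝓝[≠] z₀) (𝓝 0) := by
      have hc : ContinuousAt (fun z => (z₀ - z) • regularPart T z₀ ε z x) z₀ := by
        have := (regularPart_analyticAt hr hε hεr (Metric.mem_ball_self hε)).continuousAt
        exact (continuousAt_const.sub continuousAt_id).smul (this.clm_apply continuousAt_const)
      have := hc.tendsto.mono_left (nhdsWithin_le_nhds (s := {z₀}ᶜ))
      simpa using this
    have hconst : Tendsto (fun _ : ℂ => x - P x) (𝓝[≠] z₀) (𝓝 0) :=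
      hlim.congr' (key.mono fun z hz => hz.symm)
    have := tendsto_nhds_unique hconst tendsto_const_nhds
    exact (sub_eq_zero.mp this.symm).symm

/-- Nilpotency of `T - z₀` on the range gives one inclusion, and the projection fixing every
`kerPow` gives the other. -/
theorem range_rieszProjection_eq (hr : Metric.ball z₀ r \ {z₀} ⊆ resSet T)
    (hε : 0 < ε) (hεr : ε < r) (hfin : FinRank (rieszProjection T z₀ ε)) :
    LinearMap.range (rieszProjection T z₀ ε : H →ₗ[ℂ] H) = algEigenspace T z₀ := by
  apply le_antisymm
  · obtain ⟨N, hN, n, hn⟩ := exists_nilpotent_on_range hr hε hεr hfin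
    have h : ∀ m (x : LinearMap.range (rieszProjection T z₀ ε : H →ₗ[ℂ] H)),
        (N ^ m) x = 0 → (x : H) ∈ kerPow T z₀ m := by
      intro m
      induction m with
      | zero =>
        intro x hx
        have : x = 0 := hx
        rw [this]
        exact Submodule.zero_mem _
      | succ m ih =>
        intro x hx
        obtain ⟨h, e⟩ := hN x
        exact mem_kerPow_succ.mpr ⟨h, e ▸ ih (N x) (by rwa [pow_succ] at hx)⟩
    intro x hx
    exact (le_iSup (kerPow T z₀) n) (h n ⟨x, hx⟩ (by rw [hn]; rfl))
  · exact iSup_le fun n x hx =>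
      ⟨x, rieszProjection_apply_of_mem_kerPow hr hε hεr n x hx⟩

theorem finiteRankTrace_rieszProjection (hr : Metric.ball z₀ r \ {z₀} ⊆ resSet T)
    (hε : 0 < ε) (hεr : ε < r) (hfin : FinRank (rieszProjection T z₀ ε)) :
    finiteRankTrace (rieszProjection T z₀ ε) = algMult T z₀ := by
  rw [algMult, ← range_rieszProjection_eq hr hε hεr hfin, finiteRankTrace]
  unfold FinRank at hfin
  rw [← LinearMap.trace_id]
  congr 1
  ext x
  exact rieszProjection_apply_of_mem_range hr hε hεr x.2

/-- The resolvent near a point of `σ_d(T) ∪ ρ(T)`. -/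
theorem exists_punctured_ball_resolvent (h : z₀ ∈ discreteSpectrum T ∪ resSet T) :
    ∃ r > 0, Metric.ball z₀ r \ {z₀} ⊆ resSet T ∧ FinMero z₀ (resolventOp T) ∧
      ∀ ε, 0 < ε → ε < r → FinRank (rieszProjection T z₀ ε) ∧
        finiteRankTrace (rieszProjection T z₀ ε) = algMult T z₀ := by
  suffices hs : ∃ r > 0, Metric.ball z₀ r \ {z₀} ⊆ resSet T ∧
      ∀ ε, 0 < ε → ε < r → FinRank (rieszProjection T z₀ ε) by
    obtain ⟨r, hr0, hr, hfin⟩ := hs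
    refine ⟨r, hr0, hr, ?_, fun ε hε hεr => ⟨hfin ε hε hεr,
      finiteRankTrace_rieszProjection hr hε hεr (hfin ε hε hεr)⟩⟩
    exact resolventOp_finMero hr (half_pos hr0) (half_lt_self hr0)
      (hfin _ (half_pos hr0) (half_lt_self hr0))
  rcases h with ⟨-, r, hr0, hr, hfin⟩ | h
  · exact ⟨r, hr0, hr, hfin⟩
  -- At a point of the resolvent set the resolvent is analytic on a full disc, so the Riesz
  -- projection is `0`.
  · obtain ⟨r, hr0, hr⟩ := Metric.isOpen_iff.mp isOpen_resSet z₀ h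
    refine ⟨r, hr0, fun z hz => hr hz.1, fun ε hε hεr => ?_⟩
    have h0 : (∮ ζ in C(z₀, ε), resolventOp T ζ) = 0 :=
      circleIntegral_eq_zero_of_differentiableOn hε.le fun z hz =>
        (resolventOp_analyticAt
          (hr (Metric.closedBall_subset_ball hεr hz))).differentiableAt.differentiableWithinAt
    rw [rieszProjection, h0, smul_zero, neg_zero]
    exact FinRank.zero

end Riesz

theorem isClosed_subMap {X : Type*} [NormedAddCommGroup X] [InnerProductSpace ℂ X]
    {Θ : X →ₗ.[ℂ] X} (hΘ : Θ.IsClosed) {M : X →ₗ[ℂ] X} (hM : Continuous M) :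
    (subMap Θ M).IsClosed := by
  have h : ((subMap Θ M).graph : Set (X × X)) =
      (fun p : X × X => (p.1, p.2 + M p.1)) ⁻¹' (Θ.graph : Set (X × X)) := by
    ext ⟨x, y⟩
    simp only [Set.mem_preimage, SetLike.mem_coe, LinearPMap.mem_graph_iff]
    constructor
    · rintro ⟨a, rfl, rfl⟩
      exact ⟨a, rfl, (sub_add_cancel _ _).symm⟩
    · rintro ⟨a, rfl, ha⟩
      exact ⟨a, rfl, sub_eq_iff_eq_add.mpr ha⟩
  rw [LinearPMap.IsClosed, h]
  exact IsClosed.preimage (by fun_prop) hΘ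

/-! ### Hilbert space tools: automatic continuity, right inverses, resolvents of self-adjoint
operators. -/

section HilbertSpace

variable {X Y : Type*} [NormedAddCommGroup X] [InnerProductSpace ℂ X] [CompleteSpace X]
  [NormedAddCommGroup Y] [InnerProductSpace ℂ Y] [CompleteSpace Y]

/-- An everywhere defined linear map with an everywhere defined formal adjoint is continuous. -/
theorem continuous_of_formalAdjoint (f : X →ₗ[ℂ] Y) (g : Y → X)
    (h : ∀ x y, inner ℂ (f x) y = inner ℂ x (g y)) : Continuous f := by
  refine f.continuous_of_seq_closed_graph fun u x y hu hfu => ?_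
  refine ext_inner_right ℂ fun v => ?_
  have h1 : Tendsto (fun n => inner ℂ (f (u n)) v) atTop (𝓝 (inner ℂ y v)) :=
    hfu.inner tendsto_const_nhds
  have h2 : Tendsto (fun n => inner ℂ (u n) (g v)) atTop (𝓝 (inner ℂ x (g v))) :=
    hu.inner tendsto_const_nhds
  rw [h x v]
  exact tendsto_nhds_unique (h1.congr fun n => h (u n) v) h2

/-- Restricted to the orthogonal complement of its kernel, `A` is a continuous bijection, hence an
isomorphism. -/
theorem exists_rightInverse_of_surjective (A : X →L[ℂ] Y) (hA : Function.Surjective A) :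
    ∃ Q : Y →L[ℂ] X, A ∘L Q = ContinuousLinearMap.id ℂ Y := by
  let N := LinearMap.ker (A : X →ₗ[ℂ] Y)
  have hN : IsClosed (N : Set X) := A.isClosed_ker
  have : CompleteSpace N := hN.completeSpace_coe
  let L : Nᗮ →L[ℂ] Y := A ∘L Nᗮ.subtypeL
  have hker : L.ker = ⊥ := by
    rw [LinearMap.ker_eq_bot']
    intro x hx
    have h1 : (x : X) ∈ N := hx
    have h2 : (x : X) ∈ N ⊓ Nᗮ := ⟨h1, x.2⟩
    rw [Submodule.inf_orthogonal_eq_bot] at h2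
    exact Subtype.ext h2
  have hran : L.range = ⊤ := by
    rw [LinearMap.range_eq_top]
    intro y
    obtain ⟨x, rfl⟩ := hA y
    obtain ⟨a, ha, c, hc, rfl⟩ := N.exists_add_mem_mem_orthogonal x
    refine ⟨⟨c, hc⟩, ?_⟩
    have ha' : A a = 0 := ha
    change A c = A (a + c)
    rw [map_add, ha', zero_add]
  let e := ContinuousLinearEquiv.ofBijective L hker hran
  refine ⟨Nᗮ.subtypeL ∘L (e.symm : Y →L[ℂ] Nᗮ), ?_⟩
  ext y
  exact e.apply_symm_apply y

/-- The adjoint of the resolvent at `z` inverts `A - z̄`. -/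
theorem conj_mem_resSet {A : X →ₗ.[ℂ] X} (hA : IsSelfAdjoint A) {z : ℂ} (hz : z ∈ resSet A) :
    starRingEnd ℂ z ∈ resSet A := by
  have hdense := hA.dense_domain
  have hadj : A.adjoint = A := hA
  have hsymm : ∀ x y : A.domain, inner ℂ (A x) (y : X) = inner ℂ (x : X) (A y) := by
    have h := LinearPMap.adjoint_isFormalAdjoint hdense
    rw [hadj] at h
    exact h
  let R := resolventOp A z
  have hR : ∀ h, ∀ x : A.domain,
      inner ℂ (h + starRingEnd ℂ z • (R.adjoint h)) (x : X) = inner ℂ (R.adjoint h) (A x) := by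
    intro h x
    have h1 := resolventOp_apply_sub hz x
    have h2 : inner ℂ (R.adjoint h) (A x - z • (x : X)) = inner ℂ h (x : X) := by
      rw [ContinuousLinearMap.adjoint_inner_left, h1]
    rw [inner_sub_right, inner_smul_right, sub_eq_iff_eq_add] at h2
    rw [h2, inner_add_left, inner_smul_left, Complex.conj_conj]
  refine ⟨R.adjoint, fun h => ?_, fun x => ?_⟩
  · have hmem : R.adjoint h ∈ A.adjoint.domain :=
      LinearPMap.mem_adjoint_domain_of_exists _ ⟨_, hR h⟩
    have hval := LinearPMap.adjoint_apply_eq hdense ⟨_, hmem⟩ (hR h)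
    have key : ∃ h' : R.adjoint h ∈ A.domain,
        A ⟨_, h'⟩ = h + starRingEnd ℂ z • (R.adjoint h) := by
      have : ∃ h' : R.adjoint h ∈ A.adjoint.domain,
          A.adjoint ⟨_, h'⟩ = h + starRingEnd ℂ z • (R.adjoint h) := ⟨hmem, hval⟩
      rwa [hadj] at this
    obtain ⟨h', e⟩ := key
    exact ⟨h', sub_eq_iff_eq_add.mpr e⟩
  · refine ext_inner_right ℂ fun h => ?_
    change inner ℂ (R.adjoint (A x - starRingEnd ℂ z • (x : X))) h = inner ℂ (x : X) h
    obtain ⟨h', e⟩ := resolventOp_mem hz h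
    rw [ContinuousLinearMap.adjoint_inner_left, inner_sub_left, inner_smul_left,
      Complex.conj_conj, hsymm x ⟨_, h'⟩, e, inner_add_right, inner_smul_right]
    simp [R]

end HilbertSpace

/-! ### The γ-field, the Weyl function and Krein's formula. -/

namespace BoundaryTriple

variable {H : Type*} [NormedAddCommGroup H] [InnerProductSpace ℂ H] [CompleteSpace H]
  {S : H →ₗ.[ℂ] H} {G : Type*} [NormedAddCommGroup G] [InnerProductSpace ℂ G]
  (b : BoundaryTriple S G)

theorem exists_kerExtension_apply {f : S.adjoint.domain} (hf : b.Γ₀ f = 0) :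
    ∃ h : (f : H) ∈ b.kerExtension.domain, b.kerExtension ⟨f, h⟩ = S.adjoint f :=
  ⟨⟨⟨f, hf, rfl⟩, f.2⟩, LinearPMap.domRestrict_apply rfl⟩

theorem exists_lift_kerExtension (x : b.kerExtension.domain) :
    ∃ f : S.adjoint.domain, (f : H) = x ∧ b.Γ₀ f = 0 ∧ S.adjoint f = b.kerExtension x := by
  obtain ⟨x, ⟨⟨f, hf, hfx⟩, hx'⟩⟩ := x
  exact ⟨f, hfx, hf, (LinearPMap.domRestrict_apply hfx.symm).symm⟩

theorem exists_extension_apply {Θ : G →ₗ.[ℂ] G} {f : S.adjoint.domain}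
    (hf : (b.Γ₀ f, b.Γ₁ f) ∈ Θ.graph) :
    ∃ h : (f : H) ∈ (b.extension Θ).domain, b.extension Θ ⟨f, h⟩ = S.adjoint f :=
  ⟨⟨⟨f, hf, rfl⟩, f.2⟩, LinearPMap.domRestrict_apply rfl⟩

theorem exists_lift_extension {Θ : G →ₗ.[ℂ] G} (x : (b.extension Θ).domain) :
    ∃ f : S.adjoint.domain, (f : H) = x ∧ (b.Γ₀ f, b.Γ₁ f) ∈ Θ.graph ∧
      S.adjoint f = b.extension Θ x := by
  obtain ⟨x, ⟨⟨f, hf, hfx⟩, hx'⟩⟩ := x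
  exact ⟨f, hfx, hf, (LinearPMap.domRestrict_apply hfx.symm).symm⟩

variable {b} {z w : ℂ}

theorem exists_lift_resolvent (hz : z ∈ resSet b.kerExtension) (h : H) :
    ∃ f : S.adjoint.domain, (f : H) = resolventOp b.kerExtension z h ∧ b.Γ₀ f = 0 ∧
      S.adjoint f = h + z • (f : H) := by
  obtain ⟨h1, e⟩ := resolventOp_mem hz h
  obtain ⟨f, hf, hf0, hf1⟩ := b.exists_lift_kerExtension ⟨_, h1⟩
  refine ⟨f, hf, hf0, ?_⟩
  rw [hf1, e, hf]

theorem resolvent_apply_sub (hz : z ∈ resSet b.kerExtension) {f : S.adjoint.domain}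
    (hf : b.Γ₀ f = 0) : resolventOp b.kerExtension z (S.adjoint f - z • (f : H)) = f := by
  obtain ⟨h, e⟩ := b.exists_kerExtension_apply hf
  have := resolventOp_apply_sub hz ⟨f, h⟩
  rwa [e] at this

theorem mem_defect {f : S.adjoint.domain} :
    f ∈ defect S z ↔ S.adjoint f = z • (f : H) := by
  change S.adjoint f - z • (f : H) = 0 ↔ _
  rw [sub_eq_zero]

/-- This is the decomposition of `dom S*` into `dom A₀ = ker Γ₀` and `ker (S* - z)`: subtracting
`(A₀ - z)⁻¹(S* - z) f` from `f` lands in the defect space without changing `Γ₀ f`. -/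
theorem bijective_domRestrict_defect (hz : z ∈ resSet b.kerExtension) :
    Function.Bijective (b.Γ₀.domRestrict (defect S z)) := by
  constructor
  · rw [injective_iff_map_eq_zero]
    rintro ⟨f, hf⟩ hf0
    have h := resolvent_apply_sub hz (f := f) hf0
    rw [mem_defect.mp hf, sub_self, map_zero] at h
    exact Subtype.ext (Subtype.ext h.symm)
  · intro φ
    obtain ⟨f, hf⟩ := b.surjective (φ, 0)
    have hf0 : b.Γ₀ f = φ := congrArg Prod.fst hf
    obtain ⟨v, hv, hv0, hv1⟩ := exists_lift_resolvent hz (S.adjoint f - z • (f : H))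
    refine ⟨⟨f - v, mem_defect.mpr ?_⟩, ?_⟩
    · rw [LinearPMap.map_sub, hv1, Submodule.coe_sub]
      module
    · change b.Γ₀ (f - v) = φ
      rw [map_sub, hv0, sub_zero, hf0]

theorem gammaField_spec (hz : z ∈ resSet b.kerExtension) (φ : G) :
    b.Γ₀ (b.gammaField z φ) = φ ∧
      S.adjoint (b.gammaField z φ) = z • (b.gammaField z φ : H) := by
  have hbij := bijective_domRestrict_defect hz
  unfold gammaField
  rw [dif_pos hbij]
  exact ⟨(LinearEquiv.ofBijective _ hbij).apply_symm_apply φ,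
    mem_defect.mp ((LinearEquiv.ofBijective _ hbij).symm φ).2⟩

theorem gammaField_eq (hz : z ∈ resSet b.kerExtension) {f : S.adjoint.domain}
    (hf : S.adjoint f = z • (f : H)) : b.gammaField z (b.Γ₀ f) = f := by
  obtain ⟨h1, h2⟩ := gammaField_spec hz (b.Γ₀ f)
  have := (bijective_domRestrict_defect hz).1
    (a₁ := ⟨b.gammaField z (b.Γ₀ f), mem_defect.mpr h2⟩) (a₂ := ⟨f, mem_defect.mpr hf⟩) h1
  exact congrArg Subtype.val this

/-- Green's identity for `γ(z̄)φ` and `(A₀ - z)⁻¹ h`. -/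
theorem inner_gammaField (hz' : starRingEnd ℂ z ∈ resSet b.kerExtension) {h : H}
    {f : S.adjoint.domain} (hf0 : b.Γ₀ f = 0) (hf : S.adjoint f = h + z • (f : H)) (φ : G) :
    inner ℂ (b.gammaField (starRingEnd ℂ z) φ : H) h = inner ℂ φ (b.Γ₁ f) := by
  obtain ⟨h1, h2⟩ := gammaField_spec hz' φ
  have hg := b.green f (b.gammaField (starRingEnd ℂ z) φ)
  rw [h1, h2, hf0, hf, inner_zero_right, sub_zero, inner_add_right, inner_smul_left,
    inner_smul_right, Complex.conj_conj, add_sub_cancel_right] at hg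
  exact hg

/-- Green's identity for `γ(z)φ` and `γ(z̄)ψ`; its left side vanishes because the eigenvalues are
conjugate. -/
theorem inner_weyl (hz : z ∈ resSet b.kerExtension)
    (hz' : starRingEnd ℂ z ∈ resSet b.kerExtension) (φ ψ : G) :
    inner ℂ (b.weyl z φ) ψ = inner ℂ φ (b.weyl (starRingEnd ℂ z) ψ) := by
  obtain ⟨h1, h2⟩ := gammaField_spec hz φ
  obtain ⟨h3, h4⟩ := gammaField_spec hz' ψ
  have hg := b.green (b.gammaField (starRingEnd ℂ z) ψ) (b.gammaField z φ)
  rw [h1, h2, h3, h4, inner_smul_left, inner_smul_right, sub_self] at hg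
  exact (sub_eq_zero.mp hg.symm).symm

/-- The right side lies in `ker (S* - z)` and has boundary value `Γ₀ = φ`, which determines it. -/
theorem gammaField_transfer (hz : z ∈ resSet b.kerExtension) (hw : w ∈ resSet b.kerExtension)
    (φ : G) {v : S.adjoint.domain}
    (hv : (v : H) = resolventOp b.kerExtension z (b.gammaField w φ)) (hv0 : b.Γ₀ v = 0) :
    b.gammaField z φ = b.gammaField w φ + (z - w) • v := by
  obtain ⟨h1, h2⟩ := gammaField_spec hw φ
  obtain ⟨v', hv', hv0', hv1⟩ := exists_lift_resolvent hz (b.gammaField w φ : H)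
  obtain rfl : v = v' := Subtype.ext (hv.trans hv'.symm)
  have h := gammaField_eq hz (f := b.gammaField w φ + (z - w) • v) (by
    rw [LinearPMap.map_add, LinearPMap.map_smul, h2, hv1, Submodule.coe_add, Submodule.coe_smul]
    module)
  rwa [map_add, map_smul, hv0, smul_zero, add_zero, h1] at h

/-- Under this equation `γ(z)φ` satisfies the boundary condition of the extension, hence is in the
kernel of the extension minus `z`. -/
theorem eq_zero_of_weyl_eq {Θ : G →ₗ.[ℂ] G} (hz : z ∈ resSet b.kerExtension)
    (hzB : z ∈ resSet (b.extension Θ)) {φ : Θ.domain} (hφ : Θ φ = b.weyl z φ) : φ = 0 := by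
  obtain ⟨h1, h2⟩ := gammaField_spec hz (φ : G)
  obtain ⟨h, e⟩ := b.exists_extension_apply (Θ := Θ) (f := b.gammaField z φ)
    ((LinearPMap.mem_graph_iff Θ).mpr ⟨φ, h1.symm, hφ⟩)
  have h3 := resolventOp_apply_sub hzB ⟨_, h⟩
  rw [e, h2, sub_self, map_zero] at h3
  have h4 : b.gammaField z φ = 0 := Subtype.ext h3.symm
  rw [h4, map_zero] at h1
  exact Subtype.ext h1.symm

variable [CompleteSpace G]

/-- The map `h ↦ Γ₁ (A₀ - z̄)⁻¹ h` is an everywhere defined formal adjoint, so the closed graph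
theorem applies without any continuity of `Γ₁`. -/
theorem continuous_gammaField (hA : IsSelfAdjoint b.kerExtension)
    (hz : z ∈ resSet b.kerExtension) :
    Continuous (S.adjoint.domain.subtype ∘ₗ b.gammaField z) := by
  have hz' := conj_mem_resSet hA hz
  choose f _ hf0 hf1 using exists_lift_resolvent hz'
  refine continuous_of_formalAdjoint _ (fun h => b.Γ₁ (f h)) fun φ h => ?_
  have := inner_gammaField (by rwa [Complex.conj_conj]) (hf0 h) (hf1 h) φ
  rwa [Complex.conj_conj] at this

theorem continuous_weyl (hA : IsSelfAdjoint b.kerExtension) (hz : z ∈ resSet b.kerExtension) :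
    Continuous (b.weyl z) :=
  continuous_of_formalAdjoint _ _ (inner_weyl hz (conj_mem_resSet hA hz))

open Classical in
/-- The `γ`-field as a bounded operator into `H`; `0` where it is not bounded. -/
noncomputable def gammaL (b : BoundaryTriple S G) (z : ℂ) : G →L[ℂ] H :=
  if h : Continuous (S.adjoint.domain.subtype ∘ₗ b.gammaField z) then ⟨_, h⟩ else 0

open Classical in
/-- The Weyl function as a bounded operator; `0` where it is not bounded. -/
noncomputable def weylL (b : BoundaryTriple S G) (z : ℂ) : G →L[ℂ] G :=
  if h : Continuous (b.weyl z) then ⟨_, h⟩ else 0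

/-- The operator `γ(z̄)* = Γ₁ (A₀ - z)⁻¹`. -/
noncomputable def gammaAdj (b : BoundaryTriple S G) (z : ℂ) : H →L[ℂ] G :=
  (b.gammaL (starRingEnd ℂ z)).adjoint

theorem gammaL_apply (hA : IsSelfAdjoint b.kerExtension) (hz : z ∈ resSet b.kerExtension)
    (φ : G) : b.gammaL z φ = b.gammaField z φ := by
  unfold gammaL
  rw [dif_pos (continuous_gammaField hA hz)]
  rfl

theorem weylL_apply (hA : IsSelfAdjoint b.kerExtension) (hz : z ∈ resSet b.kerExtension)
    (φ : G) : b.weylL z φ = b.weyl z φ := by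
  unfold weylL
  rw [dif_pos (continuous_weyl hA hz)]
  rfl

theorem gammaAdj_apply (hA : IsSelfAdjoint b.kerExtension) (hz : z ∈ resSet b.kerExtension)
    {h : H} {f : S.adjoint.domain} (hf : (f : H) = resolventOp b.kerExtension z h) :
    b.gammaAdj z h = b.Γ₁ f := by
  obtain ⟨f', hf', hf0, hf1⟩ := exists_lift_resolvent hz h
  obtain rfl : f = f' := Subtype.ext (hf.trans hf'.symm)
  have hz' := conj_mem_resSet hA hz
  refine ext_inner_left ℂ fun φ => ?_
  rw [gammaAdj, ContinuousLinearMap.adjoint_inner_right, gammaL_apply hA hz',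
    inner_gammaField hz' hf0 hf1]

theorem gammaL_transfer (hA : IsSelfAdjoint b.kerExtension) (hz : z ∈ resSet b.kerExtension)
    (hw : w ∈ resSet b.kerExtension) :
    b.gammaL z = (1 + (z - w) • resolventOp b.kerExtension z) ∘L b.gammaL w := by
  ext φ
  obtain ⟨v, hv, hv0, -⟩ := exists_lift_resolvent hz (b.gammaField w φ : H)
  rw [gammaL_apply hA hz, gammaField_transfer hz hw φ hv hv0, Submodule.coe_add,
    Submodule.coe_smul, hv]
  simp [gammaL_apply hA hw]

theorem gammaAdj_transfer (hA : IsSelfAdjoint b.kerExtension) (hz : z ∈ resSet b.kerExtension)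
    (hw : w ∈ resSet b.kerExtension) :
    b.gammaAdj z = b.gammaAdj w ∘L (1 + (z - w) • resolventOp b.kerExtension z) := by
  ext h
  obtain ⟨f, hf, -⟩ := exists_lift_resolvent hz h
  obtain ⟨f', hf', -⟩ := exists_lift_resolvent hw (h + (z - w) • resolventOp b.kerExtension z h)
  have e : f = f' := by
    refine Subtype.ext ?_
    have h1 := DFunLike.congr_fun (resolventOp_sub hz hw) h
    rw [resolventOp_comm hz hw] at h1
    simp only [sub_apply, smul_apply, ContinuousLinearMap.comp_apply] at h1
    rw [hf, hf', map_add, map_smul, ← h1]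
    abel
  rw [gammaAdj_apply hA hz hf, e]
  exact (gammaAdj_apply hA hw hf').symm

/-- Apply `Γ₁` to the transfer formula of the γ-field. Dividing by `w - z` and letting `w → z`
yields `M' = γ(z̄)* γ(z)`. -/
theorem weylL_sub (hA : IsSelfAdjoint b.kerExtension) (hz : z ∈ resSet b.kerExtension)
    (hw : w ∈ resSet b.kerExtension) :
    b.weylL w - b.weylL z = (w - z) • (b.gammaAdj z ∘L b.gammaL w) := by
  ext φ
  obtain ⟨v, hv, hv0, -⟩ := exists_lift_resolvent hz (b.gammaField w φ : H)
  have h := congrArg b.Γ₁ (gammaField_transfer hz hw φ hv hv0)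
  rw [map_add, map_smul] at h
  simp only [sub_apply, smul_apply, ContinuousLinearMap.comp_apply]
  rw [weylL_apply hA hz, weylL_apply hA hw, gammaL_apply hA hw, gammaAdj_apply hA hz hv]
  change b.Γ₁ (b.gammaField w φ) - b.Γ₁ (b.gammaField z φ) = _
  rw [h]
  module

/-- Surjectivity of `(Γ₀, Γ₁)` provides, for each `ψ`, an element of `dom A₀` with `Γ₁` equal to
`ψ`, so `Γ₁ (A₀ - z)⁻¹` is onto. -/
theorem exists_rightInverse_gammaAdj (hA : IsSelfAdjoint b.kerExtension)
    (hz : z ∈ resSet b.kerExtension) :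
    ∃ Q : G →L[ℂ] H, b.gammaAdj z ∘L Q = ContinuousLinearMap.id ℂ G := by
  refine exists_rightInverse_of_surjective _ fun ψ => ?_
  obtain ⟨f, hf⟩ := b.surjective (0, ψ)
  have hf0 : b.Γ₀ f = 0 := congrArg Prod.fst hf
  have hf1 : b.Γ₁ f = ψ := congrArg Prod.snd hf
  exact ⟨S.adjoint f - z • (f : H),
    (gammaAdj_apply hA hz (resolvent_apply_sub hz hf0).symm).trans hf1⟩

theorem exists_leftInverse_gammaL (hA : IsSelfAdjoint b.kerExtension)
    (hz : z ∈ resSet b.kerExtension) :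
    ∃ P : H →L[ℂ] G, P ∘L b.gammaL z = ContinuousLinearMap.id ℂ G := by
  obtain ⟨Q, hQ⟩ := exists_rightInverse_gammaAdj hA (conj_mem_resSet hA hz)
  rw [gammaAdj, Complex.conj_conj] at hQ
  refine ⟨Q.adjoint, ?_⟩
  have := congrArg ContinuousLinearMap.adjoint hQ
  rwa [ContinuousLinearMap.adjoint_comp, ContinuousLinearMap.adjoint_adjoint,
    ContinuousLinearMap.adjoint_id] at this

section Krein

variable {Θ : G →ₗ.[ℂ] G}

/-- Krein's formula in vector form. -/
theorem exists_resolvent_sub_eq (hA : IsSelfAdjoint b.kerExtension)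
    (hz : z ∈ resSet b.kerExtension) (hzB : z ∈ resSet (b.extension Θ)) (h : H) :
    ∃ φ : Θ.domain, Θ φ - b.weyl z φ = b.gammaAdj z h ∧
      resolventOp (b.extension Θ) z h - resolventOp b.kerExtension z h = b.gammaL z φ := by
  obtain ⟨v, hv, hv0, hv1⟩ := exists_lift_resolvent hz h
  obtain ⟨h1, e⟩ := resolventOp_mem hzB h
  obtain ⟨u, hu, huΘ, hu1⟩ := b.exists_lift_extension ⟨_, h1⟩
  obtain ⟨φ, hφ, hΘφ⟩ := (LinearPMap.mem_graph_iff Θ).mp huΘ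
  -- The difference of the two resolvents applied to `h` lies in `ker (S* - z)`, and `Γ₀ v = 0`, so
  -- its boundary value is `φ`.
  have hγ : b.gammaField z φ = u - v := by
    have h2 := gammaField_eq hz (f := u - v) (by
      rw [LinearPMap.map_sub, hu1, e, hv1, Submodule.coe_sub, hu]
      module)
    rw [map_sub, hv0, sub_zero] at h2
    rw [hφ]
    exact h2
  refine ⟨φ, ?_, ?_⟩
  · change Θ φ - b.Γ₁ (b.gammaField z φ) = _
    rw [hγ, map_sub, gammaAdj_apply hA hz hv, hΘφ]
    abel
  · rw [gammaL_apply hA hz, hγ, Submodule.coe_sub, hu, hv]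

/-- The inverse of `Θ - M(z)`, written with one-sided inverses `P` and `Q` of `γ(w)` and
`γ(w̄)*`. -/
noncomputable def weylInv (b : BoundaryTriple S G) (Θ : G →ₗ.[ℂ] G) (w : ℂ) (P : H →L[ℂ] G)
    (Q : G →L[ℂ] H) (z : ℂ) : G →L[ℂ] G :=
  (P ∘L (1 + (w - z) • resolventOp b.kerExtension w)) ∘L
    ((resolventOp (b.extension Θ) z - resolventOp b.kerExtension z) ∘L
      ((1 + (w - z) • resolventOp b.kerExtension w) ∘L Q))

/-- Krein's formula solved for `(Θ - M(z))⁻¹`: the factors `1 + (w - z)(A₀ - w)⁻¹` replace `γ(z)`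
and `γ(z̄)*` by `γ(w)` and `γ(w̄)*`, which `P` and `Q` then strip off. As `P`, `Q` and `w` do not
depend on `z`, regularity in `z` is inherited from the two resolvents. -/
theorem isBoundedInverse_weylInv (hA : IsSelfAdjoint b.kerExtension)
    (hw : w ∈ resSet b.kerExtension) {P : H →L[ℂ] G} {Q : G →L[ℂ] H}
    (hP : P ∘L b.gammaL w = ContinuousLinearMap.id ℂ G)
    (hQ : b.gammaAdj w ∘L Q = ContinuousLinearMap.id ℂ G)
    (hz : z ∈ resSet b.kerExtension) (hzB : z ∈ resSet (b.extension Θ)) :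
    IsBoundedInverse (subMap Θ (b.weyl z)) (b.weylInv Θ w P Q z) := by
  have hright : ∀ y, ∃ φ : Θ.domain, b.weylInv Θ w P Q z y = φ ∧ Θ φ - b.weyl z φ = y := by
    intro y
    obtain ⟨φ, h1, h2⟩ := exists_resolvent_sub_eq (Θ := Θ) hA hz hzB
      ((1 + (w - z) • resolventOp b.kerExtension w) (Q y))
    refine ⟨φ, ?_, ?_⟩
    · have h3 : b.weylInv Θ w P Q z y =
          P ((1 + (w - z) • resolventOp b.kerExtension w) (b.gammaL z φ)) := by
        rw [← h2]
        rfl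
      have h4 : (1 + (w - z) • resolventOp b.kerExtension w) (b.gammaL z φ) = b.gammaL w φ :=
        (DFunLike.congr_fun (gammaL_transfer hA hw hz) (φ : G)).symm
      rw [h3, h4]
      exact DFunLike.congr_fun hP (φ : G)
    · have h3 := DFunLike.congr_fun (gammaAdj_transfer hA hw hz) (Q y)
      rw [h1]
      exact h3.symm.trans (DFunLike.congr_fun hQ y)
  refine ⟨fun y => ?_, fun (x : Θ.domain) => ?_⟩
  · obtain ⟨φ, h1, h2⟩ := hright y
    rw [h1]
    exact ⟨φ.2, h2⟩
  · change b.weylInv Θ w P Q z (Θ x - b.weyl z x) = x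
    obtain ⟨φ, h1, h2⟩ := hright (Θ x - b.weyl z x)
    rw [h1]
    -- Both `φ` and `x` solve the same equation, so `Θ - M(z)` annihilates their difference.
    have h3 : φ - x = 0 := by
      refine eq_zero_of_weyl_eq hz hzB ?_
      rw [LinearPMap.map_sub, Submodule.coe_sub, map_sub, sub_eq_sub_iff_sub_eq_sub]
      exact h2
    rw [sub_eq_zero.mp h3]

theorem krein_formula (hA : IsSelfAdjoint b.kerExtension)
    (hz : z ∈ resSet b.kerExtension) (hzB : z ∈ resSet (b.extension Θ)) {R : G →L[ℂ] G}
    (hR : IsBoundedInverse (subMap Θ (b.weyl z)) R) :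
    (b.gammaL z ∘L R) ∘L b.gammaAdj z =
      resolventOp (b.extension Θ) z - resolventOp b.kerExtension z := by
  ext h
  obtain ⟨φ, h1, h2⟩ := exists_resolvent_sub_eq (Θ := Θ) hA hz hzB h
  have h3 : R (Θ φ - b.weyl z φ) = φ := hR.2 φ
  rw [sub_apply, h2, ContinuousLinearMap.comp_apply, ContinuousLinearMap.comp_apply, ← h1, h3]

end Krein

end BoundaryTriple

theorem finitelyMeromorphicOn_ball {G : Type*} [NormedAddCommGroup G] [InnerProductSpace ℂ G]
    {f : ℂ → G →L[ℂ] G} {z₀ : ℂ} {r : ℝ} (hf : FinMero z₀ f)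
    (ha : AnalyticOnNhd ℂ f (Metric.ball z₀ r \ {z₀})) :
    FinitelyMeromorphicOn f (Metric.ball z₀ r) := by
  intro z hz
  by_cases h : z = z₀
  · rw [h]
    exact hf.finitelyMeromorphicAt
  · exact (FinMero.analytic (ha z ⟨hz, h⟩)).finitelyMeromorphicAt

theorem eventually_nhdsNE_of_forall_punctured_ball {z₀ : ℂ} {r : ℝ} (hr : 0 < r) {p : ℂ → Prop}
    (h : ∀ z ∈ Metric.ball z₀ r \ {z₀}, p z) : ∀ᶠ z in 𝓝[≠] z₀, p z := by
  rw [eventually_nhdsWithin_iff]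
  filter_upwards [Metric.ball_mem_nhds z₀ hr] with z hz hz0 using h z ⟨hz, hz0⟩

/-! ### Analyticity and finite meromorphy of the γ-field and the Weyl function. -/

namespace BoundaryTriple

variable {H : Type*} [NormedAddCommGroup H] [InnerProductSpace ℂ H] [CompleteSpace H]
  {S : H →ₗ.[ℂ] H} {G : Type*} [NormedAddCommGroup G] [InnerProductSpace ℂ G]
  {b : BoundaryTriple S G} {z z₀ : ℂ}

theorem weylInv_analyticAt {Θ : G →ₗ.[ℂ] G} {w : ℂ} (P : H →L[ℂ] G) (Q : G →L[ℂ] H)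
    (hz : z ∈ resSet b.kerExtension) (hzB : z ∈ resSet (b.extension Θ)) :
    AnalyticAt ℂ (b.weylInv Θ w P Q) z := by
  have h1 : AnalyticAt ℂ (fun z => 1 + (w - z) • resolventOp b.kerExtension w) z := by fun_prop
  have h2 := (resolventOp_analyticAt hzB).sub (resolventOp_analyticAt hz)
  exact analyticAt_clm_comp (analyticAt_clm_comp analyticAt_const h1)
    (analyticAt_clm_comp h2 (analyticAt_clm_comp h1 analyticAt_const))

theorem weylInv_finMero {Θ : G →ₗ.[ℂ] G} {w : ℂ} (P : H →L[ℂ] G) (Q : G →L[ℂ] H)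
    (hR : FinMero z₀ (resolventOp b.kerExtension))
    (hRB : FinMero z₀ (resolventOp (b.extension Θ))) : FinMero z₀ (b.weylInv Θ w P Q) := by
  have h1 : FinMero z₀ (fun z => 1 + (w - z) • resolventOp b.kerExtension w) :=
    .analytic (by fun_prop)
  exact .comp (.comp (.analytic analyticAt_const) h1)
    (.comp (hRB.sub hR) (.comp h1 (.analytic analyticAt_const)))

variable [CompleteSpace G]

theorem gammaL_analyticAt (hA : IsSelfAdjoint b.kerExtension) (hz : z ∈ resSet b.kerExtension) :
    AnalyticAt ℂ b.gammaL z := by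
  have hR := resolventOp_analyticAt hz
  have h : AnalyticAt ℂ
      (fun x => (1 + (x - z) • resolventOp b.kerExtension x) ∘L b.gammaL z) z :=
    analyticAt_clm_comp (by fun_prop) analyticAt_const
  refine h.congr ?_
  filter_upwards [isOpen_resSet.mem_nhds hz] with x hx using (gammaL_transfer hA hx hz).symm

theorem gammaAdj_analyticAt (hA : IsSelfAdjoint b.kerExtension)
    (hz : z ∈ resSet b.kerExtension) : AnalyticAt ℂ b.gammaAdj z := by
  have hR := resolventOp_analyticAt hz
  have h : AnalyticAt ℂ
      (fun x => b.gammaAdj z ∘L (1 + (x - z) • resolventOp b.kerExtension x)) z :=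
    analyticAt_clm_comp analyticAt_const (by fun_prop)
  refine h.congr ?_
  filter_upwards [isOpen_resSet.mem_nhds hz] with x hx using (gammaAdj_transfer hA hx hz).symm

theorem weylL_eventuallyEq (hA : IsSelfAdjoint b.kerExtension)
    (hz : z ∈ resSet b.kerExtension) :
    (fun x => b.weylL z + (x - z) • (b.gammaAdj z ∘L b.gammaL x)) =ᶠ[𝓝 z] b.weylL := by
  filter_upwards [isOpen_resSet.mem_nhds hz] with x hx
  rw [← weylL_sub hA hz hx]
  abel

theorem weylL_analyticAt (hA : IsSelfAdjoint b.kerExtension) (hz : z ∈ resSet b.kerExtension) :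
    AnalyticAt ℂ b.weylL z := by
  refine AnalyticAt.congr ?_ (weylL_eventuallyEq hA hz)
  have h : AnalyticAt ℂ (fun x => b.gammaAdj z ∘L b.gammaL x) z :=
    analyticAt_clm_comp analyticAt_const (gammaL_analyticAt hA hz)
  fun_prop

theorem weylL_hasDerivAt (hA : IsSelfAdjoint b.kerExtension) (hz : z ∈ resSet b.kerExtension) :
    HasDerivAt b.weylL (b.gammaAdj z ∘L b.gammaL z) z := by
  refine HasDerivAt.congr_of_eventuallyEq ?_ (weylL_eventuallyEq hA hz).symm
  have h : AnalyticAt ℂ (fun x => b.gammaAdj z ∘L b.gammaL x) z :=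
    analyticAt_clm_comp analyticAt_const (gammaL_analyticAt hA hz)
  have h1 : HasDerivAt (fun x : ℂ => x - z) 1 z := (hasDerivAt_id z).sub_const z
  have h2 := (h1.smul h.differentiableAt.hasDerivAt).const_add (b.weylL z)
  simpa using h2

/-- The base point `w` is taken in the resolvent set near `z₀`, since `z₀` itself may lie in the
spectrum; all dependence on `z` then sits in the resolvent of `A₀`. -/
theorem gammaL_finMero (hA : IsSelfAdjoint b.kerExtension)
    (hev : ∀ᶠ x in 𝓝[≠] z₀, x ∈ resSet b.kerExtension)
    (hR : FinMero z₀ (resolventOp b.kerExtension)) : FinMero z₀ b.gammaL := by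
  obtain ⟨w, hw⟩ := hev.exists
  refine .congr (.comp (.add (.analytic (analyticAt_const (v := (1 : H →L[ℂ] H))))
    (hR.smul (c := fun x => x - w) (by fun_prop)))
    (.analytic (analyticAt_const (v := b.gammaL w)))) ?_
  filter_upwards [hev] with x hx using (gammaL_transfer hA hx hw).symm

theorem gammaAdj_finMero (hA : IsSelfAdjoint b.kerExtension)
    (hev : ∀ᶠ x in 𝓝[≠] z₀, x ∈ resSet b.kerExtension)
    (hR : FinMero z₀ (resolventOp b.kerExtension)) : FinMero z₀ b.gammaAdj := by
  obtain ⟨w, hw⟩ := hev.exists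
  refine .congr (.comp (.analytic (analyticAt_const (v := b.gammaAdj w)))
    (.add (.analytic (analyticAt_const (v := (1 : H →L[ℂ] H))))
    (hR.smul (c := fun x => x - w) (by fun_prop)))) ?_
  filter_upwards [hev] with x hx using (gammaAdj_transfer hA hx hw).symm

/-! ### The index hypothesis and the index of `Θ - M(·)`. -/

section Index

variable {Θ : G →ₗ.[ℂ] G}

theorem value_subMap_weyl (hA : IsSelfAdjoint b.kerExtension) (hz : z ∈ resSet b.kerExtension)
    (φ : Θ.domain) : value (subMap Θ (b.weyl z)) φ = Θ φ - b.weylL z φ := by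
  rw [weylL_apply hA hz]
  exact dif_pos φ.2

theorem isDerivExtension_subMap_weyl (hA : IsSelfAdjoint b.kerExtension)
    (hz : z ∈ resSet b.kerExtension) :
    IsDerivExtension (fun z => subMap Θ (b.weyl z)) z (-(b.gammaAdj z ∘L b.gammaL z)) := by
  intro φ hφ
  have h1 : HasDerivAt (fun x => Θ ⟨φ, hφ⟩ - b.weylL x φ)
      (-((b.gammaAdj z ∘L b.gammaL z) φ)) z := by
    have h := (weylL_hasDerivAt hA hz).clm_apply (hasDerivAt_const z φ)
    simpa using h.const_sub (Θ ⟨φ, hφ⟩)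
  have h2 : (fun x => value (subMap Θ (b.weyl x)) φ) =ᶠ[𝓝 z]
      fun x => Θ ⟨φ, hφ⟩ - b.weylL x φ := by
    filter_upwards [isOpen_resSet.mem_nhds hz] with x hx
    exact value_subMap_weyl (Θ := Θ) hA hx ⟨φ, hφ⟩
  rw [(h1.congr_of_eventuallyEq h2).deriv]
  rfl

/-- The bounded continuation is chosen arbitrarily in the definition; density of `dom Θ` makes it
unique. -/
theorem derivClosure_subMap_weyl (hA : IsSelfAdjoint b.kerExtension)
    (hΘ : Dense (Θ.domain : Set G)) (hz : z ∈ resSet b.kerExtension) :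
    derivClosure (fun z => subMap Θ (b.weyl z)) z = -(b.gammaAdj z ∘L b.gammaL z) := by
  have h := isDerivExtension_subMap_weyl (Θ := Θ) hA hz
  have hex : ∃ K : G →L[ℂ] G, IsDerivExtension (fun z => subMap Θ (b.weyl z)) z K := ⟨_, h⟩
  unfold derivClosure
  rw [dif_pos hex]
  refine DFunLike.coe_injective (Continuous.ext_on hΘ (map_continuous _) (map_continuous _) ?_)
  intro φ hφ
  rw [hex.choose_spec φ hφ, h φ hφ]

variable {r : ℝ}

theorem index_analytic (hA : IsSelfAdjoint b.kerExtension) (hΘ : Dense (Θ.domain : Set G))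
    (hrA : Metric.ball z₀ r \ {z₀} ⊆ resSet b.kerExtension)
    (hrB : Metric.ball z₀ r \ {z₀} ⊆ resSet (b.extension Θ)) :
    AnalyticOnNhd ℂ (fun z => boundedInverse (subMap Θ (b.weyl z))) (Metric.ball z₀ r \ {z₀}) ∧
    AnalyticOnNhd ℂ (derivClosure fun z => subMap Θ (b.weyl z)) (Metric.ball z₀ r \ {z₀}) := by
  have hopen : IsOpen (Metric.ball z₀ r \ {z₀}) := Metric.isOpen_ball.sdiff isClosed_singleton
  constructor
  · intro z hz
    obtain ⟨P, hP⟩ := exists_leftInverse_gammaL hA (hrA hz)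
    obtain ⟨Q, hQ⟩ := exists_rightInverse_gammaAdj hA (hrA hz)
    refine (weylInv_analyticAt (w := z) P Q (hrA hz) (hrB hz)).congr ?_
    filter_upwards [hopen.mem_nhds hz] with x hx
    exact (isBoundedInverse_weylInv hA (hrA hz) hP hQ (hrA hx) (hrB hx)).boundedInverse_eq.symm
  · intro z hz
    refine (analyticAt_clm_comp (gammaAdj_analyticAt hA (hrA hz))
      (gammaL_analyticAt hA (hrA hz))).neg.congr ?_
    filter_upwards [hopen.mem_nhds hz] with x hx
    exact (derivClosure_subMap_weyl hA hΘ (hrA hx)).symm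

theorem index_finMero (hA : IsSelfAdjoint b.kerExtension) (hΘ : Dense (Θ.domain : Set G))
    (hr : 0 < r) (hrA : Metric.ball z₀ r \ {z₀} ⊆ resSet b.kerExtension)
    (hrB : Metric.ball z₀ r \ {z₀} ⊆ resSet (b.extension Θ))
    (hR : FinMero z₀ (resolventOp b.kerExtension))
    (hRB : FinMero z₀ (resolventOp (b.extension Θ))) :
    FinMero z₀ (fun z => boundedInverse (subMap Θ (b.weyl z))) ∧
    FinMero z₀ (derivClosure fun z => subMap Θ (b.weyl z)) := by
  have hev := eventually_nhdsNE_of_forall_punctured_ball hr hrA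
  have hevB := eventually_nhdsNE_of_forall_punctured_ball hr hrB
  constructor
  · obtain ⟨w, hw⟩ := hev.exists
    obtain ⟨P, hP⟩ := exists_leftInverse_gammaL hA hw
    obtain ⟨Q, hQ⟩ := exists_rightInverse_gammaAdj hA hw
    refine .congr (weylInv_finMero (w := w) P Q hR hRB) ?_
    filter_upwards [hev, hevB] with x hx hxB
    exact (isBoundedInverse_weylInv hA hw hP hQ hx hxB).boundedInverse_eq.symm
  · refine .congr ((gammaAdj_finMero hA hev hR).comp (gammaL_finMero hA hev hR)).neg ?_
    filter_upwards [hev] with x hx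
    exact (derivClosure_subMap_weyl hA hΘ hx).symm

theorem boundedlyInvertible_subMap_weyl (hA : IsSelfAdjoint b.kerExtension)
    (hz : z ∈ resSet b.kerExtension) (hzB : z ∈ resSet (b.extension Θ)) :
    BoundedlyInvertible (subMap Θ (b.weyl z)) := by
  obtain ⟨P, hP⟩ := exists_leftInverse_gammaL hA hz
  obtain ⟨Q, hQ⟩ := exists_rightInverse_gammaAdj hA hz
  exact ⟨_, isBoundedInverse_weylInv hA hz hP hQ hz hzB⟩

theorem indexHypothesis (hA : IsSelfAdjoint b.kerExtension) (hΘ : Dense (Θ.domain : Set G))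
    (hΘc : Θ.IsClosed) (hr : 0 < r)
    (hrA : Metric.ball z₀ r \ {z₀} ⊆ resSet b.kerExtension)
    (hrB : Metric.ball z₀ r \ {z₀} ⊆ resSet (b.extension Θ))
    (hR : FinMero z₀ (resolventOp b.kerExtension))
    (hRB : FinMero z₀ (resolventOp (b.extension Θ))) :
    IndexHypothesis (fun z => subMap Θ (b.weyl z)) (Metric.ball z₀ r) {z₀} := by
  obtain ⟨ha1, ha2⟩ := index_analytic hA hΘ hrA hrB
  obtain ⟨hm1, hm2⟩ := index_finMero hA hΘ hr hrA hrB hR hRB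
  have hopen : IsOpen (Metric.ball z₀ r \ {z₀}) := Metric.isOpen_ball.sdiff isClosed_singleton
  exact {
    isOpen := Metric.isOpen_ball
    isConnected := (convex_ball z₀ r).isConnected (Metric.nonempty_ball.mpr hr)
    subset := by simpa using hr
    discrete := by
      intro z _ h
      -- Removing `z` from `{z₀}` leaves a finite, hence closed set, so its complement is a
      -- neighbourhood of `z` that meets `{z₀}` at most in `z`.
      obtain ⟨y, ⟨hy1, hy2⟩, hy3⟩ := accPt_iff_nhds.mp h ({z₀} \ {z})ᶜ
        (((Set.finite_singleton z₀).sdiff).isClosed.isOpen_compl.mem_nhds (by simp))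
      exact hy1 ⟨hy2, hy3⟩
    dense := fun z _ => hΘ
    closed := fun z hz => isClosed_subMap hΘc (continuous_weyl hA (hrA hz))
    domain_eq := fun z _ w _ => rfl
    invertible := fun z hz => boundedlyInvertible_subMap_weyl hA (hrA hz) (hrB hz)
    inverse_analytic := ha1
    inverse_finMero := finitelyMeromorphicOn_ball hm1 ha1
    strongly_analytic := by
      intro φ hφ z hz
      have hφ' : φ ∈ Θ.domain := hφ z hz
      have h := (analyticAt_const (v := Θ ⟨φ, hφ'⟩)).sub
        (((ContinuousLinearMap.apply ℂ G φ).analyticAt _).comp (weylL_analyticAt hA (hrA hz)))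
      refine h.congr ?_
      filter_upwards [hopen.mem_nhds hz] with x hx
      exact (value_subMap_weyl hA (hrA hx) ⟨φ, hφ'⟩).symm
    deriv_bounded := fun z hz => ⟨_, isDerivExtension_subMap_weyl hA (hrA hz)⟩
    deriv_analytic := ha2
    deriv_finMero := finitelyMeromorphicOn_ball hm2 ha2 }

/-- The generalized index of `Θ - M(·)` is the difference of the algebraic multiplicities of the
two extensions. -/
theorem generalizedIndex_eq (hA : IsSelfAdjoint b.kerExtension) (hΘ : Dense (Θ.domain : Set G))
    (hr : 0 < r) (hrA : Metric.ball z₀ r \ {z₀} ⊆ resSet b.kerExtension)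
    (hrB : Metric.ball z₀ r \ {z₀} ⊆ resSet (b.extension Θ))
    (hR : FinMero z₀ (resolventOp b.kerExtension))
    (hRB : FinMero z₀ (resolventOp (b.extension Θ)))
    (hPA : ∀ ε, 0 < ε → ε < r → FinRank (rieszProjection b.kerExtension z₀ ε) ∧
      finiteRankTrace (rieszProjection b.kerExtension z₀ ε) = algMult b.kerExtension z₀)
    (hPB : ∀ ε, 0 < ε → ε < r → FinRank (rieszProjection (b.extension Θ) z₀ ε) ∧
      finiteRankTrace (rieszProjection (b.extension Θ) z₀ ε) = algMult (b.extension Θ) z₀)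
    {ε : ℝ} (hε : 0 < ε) (hεr : ε < r) :
    FiniteRank (indexOperator (fun z => subMap Θ (b.weyl z)) z₀ ε) ∧
    generalizedIndex (fun z => subMap Θ (b.weyl z)) z₀ ε =
      (algMult (b.extension Θ) z₀ : ℂ) - (algMult b.kerExtension z₀ : ℂ) := by
  obtain ⟨ha1, ha2⟩ := index_analytic hA hΘ hrA hrB
  obtain ⟨hm1, -⟩ := index_finMero hA hΘ hr hrA hrB hR hRB
  have hev := eventually_nhdsNE_of_forall_punctured_ball hr hrA
  let T : ℂ → G →L[ℂ] G := fun z => boundedInverse (subMap Θ (b.weyl z))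
  -- The cyclic permutation is applied to the two factors `γ(z̄)*` and `γ(z) (Θ - M(z))⁻¹`.
  have htr := (gammaAdj_finMero hA hev hR).traceSymm ((gammaL_finMero hA hev hR).comp hm1)
  -- Trace symmetry is available only for sufficiently small radii; the index integral does not
  -- depend on the radius, so it is moved from `ε` to some `δ < ε`.
  obtain ⟨δ, ⟨-, -, hfin1, hfin2, htrace⟩, hδ0, hδε⟩ :=
    (htr.and (Ioo_mem_nhdsGT hε)).exists
  have hδr : δ < r := hδε.trans hεr
  have hsph := sphere_subset_punctured (z₀ := z₀) hδ0 hδr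
  let c : ℂ := (2 * Real.pi * Complex.I : ℂ)⁻¹
  have hop : indexOperator (fun z => subMap Θ (b.weyl z)) z₀ ε =
      (-c) • ∮ ζ in C(z₀, δ), b.gammaAdj ζ ∘L (b.gammaL ζ ∘L T ζ) := by
    have hint : (∮ ζ in C(z₀, δ), derivClosure (fun z => subMap Θ (b.weyl z)) ζ ∘L T ζ) =
        (-1 : ℂ) • ∮ ζ in C(z₀, δ), b.gammaAdj ζ ∘L (b.gammaL ζ ∘L T ζ) := by
      rw [← circleIntegral.integral_smul]
      refine circleIntegral.integral_congr hδ0.le fun ζ hζ => ?_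
      rw [derivClosure_subMap_weyl hA hΘ (hrA (hsph hζ)), neg_one_smul,
        ContinuousLinearMap.neg_comp]
      rfl
    rw [indexOperator, circleIntegral_radius_independent
      (fun z hz => analyticAt_clm_comp (ha2 z hz) (ha1 z hz)) hδ0 hδε.le hεr, hint, smul_smul,
      mul_neg_one]
  -- In the permuted order the integrand is Krein's resolvent difference.
  have hdiff : (∮ ζ in C(z₀, δ), (b.gammaL ζ ∘L T ζ) ∘L b.gammaAdj ζ) =
      (∮ ζ in C(z₀, δ), resolventOp (b.extension Θ) ζ) -
        ∮ ζ in C(z₀, δ), resolventOp b.kerExtension ζ := by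
    rw [← circleIntegral.integral_sub (resolventOp_circleIntegrable hrB hδ0 hδr)
      (resolventOp_circleIntegrable hrA hδ0 hδr)]
    refine circleIntegral.integral_congr hδ0.le fun ζ hζ => ?_
    have hζA := hrA (hsph hζ)
    have hζB := hrB (hsph hζ)
    exact krein_formula hA hζA hζB
      (isBoundedInverse_boundedInverse (boundedlyInvertible_subMap_weyl hA hζA hζB))
  -- The minus sign from differentiating `-M` is exactly the one in the definition of the Riesz
  -- projection.
  have hproj : (-c) • (∮ ζ in C(z₀, δ), (b.gammaL ζ ∘L T ζ) ∘L b.gammaAdj ζ) =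
      rieszProjection (b.extension Θ) z₀ δ + (-1 : ℂ) • rieszProjection b.kerExtension z₀ δ := by
    rw [hdiff]
    simp only [rieszProjection, c]
    module
  obtain ⟨hA1, hA2⟩ := hPA δ hδ0 hδr
  obtain ⟨hB1, hB2⟩ := hPB δ hδ0 hδr
  refine ⟨by rw [hop]; exact FinRank.smul hfin1 _, ?_⟩
  rw [generalizedIndex, hop, finiteRankTrace_smul hfin1, htrace, ← finiteRankTrace_smul hfin2,
    hproj, finiteRankTrace_add hB1 (hA1.smul _), finiteRankTrace_smul hA1, hA2, hB2]
  ring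

end Index

end BoundaryTriple

end ExtIndex

/-! ### The difference of the two indices. -/

theorem theorem4p3
    {H : Type*} [NormedAddCommGroup H] [InnerProductSpace ℂ H] [CompleteSpace H]
    {G : Type*} [NormedAddCommGroup G] [InnerProductSpace ℂ G] [CompleteSpace G]
    (B₁ B₂ S A₀ : H →ₗ.[ℂ] H) (hyp : ExtensionHypothesis B₁ B₂ S A₀)
    (b : BoundaryTriple S G) (hA₀ : A₀ = b.kerExtension)
    (Θ₁ Θ₂ : G →ₗ.[ℂ] G)
    (hΘ₁dense : Dense (Θ₁.domain : Set G)) (hΘ₁closed : Θ₁.IsClosed)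
    (hΘ₂dense : Dense (Θ₂.domain : Set G)) (hΘ₂closed : Θ₂.IsClosed)
    (hB₁ : B₁ = b.extension Θ₁) (hB₂ : B₂ = b.extension Θ₂)
    (z₀ : ℂ)
    (hz₁ : z₀ ∈ discreteSpectrum B₁ ∪ resSet B₁)
    (hz₂ : z₀ ∈ discreteSpectrum B₂ ∪ resSet B₂)
    (hz₀ : z₀ ∈ discreteSpectrum A₀ ∪ resSet A₀) :
    ∃ ε₀ > 0,
      IndexHypothesis (fun z => subMap Θ₁ (b.weyl z)) (Metric.ball z₀ ε₀) {z₀} ∧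
      IndexHypothesis (fun z => subMap Θ₂ (b.weyl z)) (Metric.ball z₀ ε₀) {z₀} ∧
      ∀ ε, 0 < ε → ε < ε₀ →
        FiniteRank (indexOperator (fun z => subMap Θ₁ (b.weyl z)) z₀ ε) ∧
        FiniteRank (indexOperator (fun z => subMap Θ₂ (b.weyl z)) z₀ ε) ∧
        generalizedIndex (fun z => subMap Θ₁ (b.weyl z)) z₀ ε -
            generalizedIndex (fun z => subMap Θ₂ (b.weyl z)) z₀ ε =
          (algMult B₁ z₀ : ℂ) - (algMult B₂ z₀ : ℂ) := by

  subst hA₀ hB₁ hB₂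
  have hA := hyp.selfAdjoint
  obtain ⟨r₀, hr₀, hrA, hRA, hPA⟩ := exists_punctured_ball_resolvent hz₀
  obtain ⟨r₁, hr₁, hrB₁, hRB₁, hPB₁⟩ := exists_punctured_ball_resolvent hz₁
  obtain ⟨r₂, hr₂, hrB₂, hRB₂, hPB₂⟩ := exists_punctured_ball_resolvent hz₂
  -- On this common disc all three resolvents exist off `z₀`.
  let r := min r₀ (min r₁ r₂)
  have hr : 0 < r := lt_min hr₀ (lt_min hr₁ hr₂)
  have h0 : r ≤ r₀ := min_le_left _ _
  have h1 : r ≤ r₁ := (min_le_right _ _).trans (min_le_left _ _)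
  have h2 : r ≤ r₂ := (min_le_right _ _).trans (min_le_right _ _)
  have hsub : ∀ {s}, r ≤ s → Metric.ball z₀ r \ {z₀} ⊆ Metric.ball z₀ s \ {z₀} := fun h =>
    Set.sdiff_subset_sdiff_left (Metric.ball_subset_ball h)
  replace hrA := (hsub h0).trans hrA
  replace hrB₁ := (hsub h1).trans hrB₁
  replace hrB₂ := (hsub h2).trans hrB₂
  refine ⟨r, hr,
    BoundaryTriple.indexHypothesis hA hΘ₁dense hΘ₁closed hr hrA hrB₁ hRA hRB₁,
    BoundaryTriple.indexHypothesis hA hΘ₂dense hΘ₂closed hr hrA hrB₂ hRA hRB₂,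
    fun ε hε hεr => ?_⟩
  obtain ⟨f₁, e₁⟩ := BoundaryTriple.generalizedIndex_eq hA hΘ₁dense hr hrA hrB₁ hRA hRB₁
    (fun δ hδ hδr => hPA δ hδ (hδr.trans_le h0)) (fun δ hδ hδr => hPB₁ δ hδ (hδr.trans_le h1))
    hε hεr
  obtain ⟨f₂, e₂⟩ := BoundaryTriple.generalizedIndex_eq hA hΘ₂dense hr hrA hrB₂ hRA hRB₂
    (fun δ hδ hδr => hPA δ hδ (hδr.trans_le h0)) (fun δ hδ hδr => hPB₂ δ hδ (hδr.trans_le h2))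
    hε hεr
  refine ⟨f₁, f₂, ?_⟩
  -- The multiplicity of `A₀` enters both indices and cancels.
  rw [e₁, e₂]
  ring
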